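/- Let $\lambda, c_1, c_2, P, \sigma_0, \beta > 0$, $\alpha > 2$, $\ell \in [0,1]$, and let $N \ge 1$ be an integer. Let $\Phi_x=\{X_i\}_{i\ge 1}$ be a homogeneous Poisson point process on $\mathbb{R}^2$ of density $\lambda$. UAV $i$ is located at $U_i = (X_i, \|X_i\|\tan\Theta_i)\in\mathbb{R}^2\times\mathbb{R}_+$, where (angle-projection-independent locating, APIL, scenario) the elevation angles $\Theta_i$ are i.i.d. copies of a random variable $\Theta$ with values in $[0,\pi/2)$ almost surely. The link from $U_i$ to the user at the origin has channel factor $L_i = 1$ if it is line-of-sight and $L_i=\ell$ otherwise; given its elevation angle $\Theta_i=\theta$, it is line-of-sight with probability $\rho(\theta) = 1/(1+c_2 e^{-c_1\theta})$, independently for different $i$. The elevation angles and line-of-sight indicators are independent of $\Phi_x$ (and of its enumeration). The channel gains $G_i$ are i.i.d. with law $\mathrm{Gamma}(N,1)$ (shape $N$, rate $1$) and independent of everything else. Let $$\omega = \mathbb{E}\Big[\cos^2(\Theta)\big(\rho(\Theta)(1-\ell^{2/\alpha})+\ell^{2/\alpha}\big)\Big], \qquad p^{cf}_{cov} = \mathbb{P}\left[\frac{P\sum_{i\ge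 1} G_i L_i \|U_i\|^{-\alpha}}{\sigma_0}\ge\beta\right],$$ the latter being the cell-free downlink coverage when all UAVs perform non-coherent joint transmission. Then $$p^{cf}_{cov} = 1-\mathcal{L}^{-1}\left\{\frac1s\exp\left[-\frac{\pi\lambda s^{2/\alpha}\omega}{(N-1)!}\,\Gamma\!\left(N+\tfrac{2}{\alpha}\right)\Gamma\!\left(1-\tfrac{2}{\alpha}\right)\right]\right\}\left(\frac{\beta\sigma_0}{P}\right),$$ where for a function $F$ holomorphic on $\{\mathrm{Re}\, s>0\}$ the inverse Laplace transform is $\mathcal{L}^{-1}\{F\}(t) = \lim_{T\to\infty}\frac{1}{2\pi i}\int_{\gamma-iT}^{\gamma+iT} e^{st}F(s)\,ds$ (for any $\gamma>0$; here the limit exists and does not depend on $\gamma$), and $s^{2/\alpha}$ is the principal power. If $\alpha=4$, then moreover $$p^{cf}_{cov} = \mathrm{erf}\left(\frac{\pi^{3/2}\lambda\omega}{2(N-1)!}\sqrt{\frac{P}{\beta\sigma_0}}\;\Gamma\!\left(N+\tfrac12\right)\right), \qquad \mathrm{erf}(z)=\frac{2}{\sqrt\pi}\int_0^z e^{-t^2}\,dt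 .$$ -/

import Mathlib

open MeasureTheory ProbabilityTheory Filter Topology
open scoped ENNReal NNReal

namespace UAV

noncomputable section

/-- The ground plane `ℝ²` with its Euclidean norm. -/
abbrev Plane : Type := EuclideanSpace ℝ (Fin 2)

/-- Three-dimensional space `ℝ² × ℝ` with its Euclidean norm `√(‖x‖² + h²)`. -/
abbrev Space : Type := WithLp 2 (Plane × ℝ)

/-- The number of points of the configuration `{x₀, x₁, …}` that lie in `B`. -/
def count {Ω E : Type*} (X : ℕ → Ω → E) (B : Set E) (w : Ω) : ℕ∞ :=
  {i : ℕ | X i w ∈ B}.encard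

/-- `X 0, X 1, …` is a (measurable) enumeration, without repetition, of the points of a Poisson
point process with intensity measure `Λ`: the number of points in a measurable set `B` with
`Λ B < ∞` is Poisson distributed with mean `Λ B`, and the numbers of points in finitely many
pairwise disjoint such sets are independent. -/
structure IsPoissonProcess {Ω E : Type*} [MeasurableSpace Ω] [MeasurableSpace E]
    (X : ℕ → Ω → E) (Λ : Measure E) (μ : Measure Ω) : Prop where
  measurable : ∀ i, Measurable (X i)
  simple : ∀ᵐ w ∂μ, Function.Injective fun i => X i w
  count_law : ∀ B : Set E, MeasurableSet B → Λ B < ∞ →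
    HasLaw (count X B) ((poissonMeasure (Λ B).toNNReal).map fun n : ℕ => (n : ℕ∞)) μ
  count_indep : ∀ (n : ℕ) (B : Fin n → Set E), (∀ j, MeasurableSet (B j)) →
    (∀ j, Λ (B j) < ∞) → Pairwise (fun j k => Disjoint (B j) (B k)) →
    iIndepFun (fun j => count X (B j)) μ

/-- The line-of-sight probability `ρ(θ) = 1 / (1 + c₂ exp(-c₁ θ))` at elevation angle `θ`. -/
def losProb (c₁ c₂ θ : ℝ) : ℝ := 1 / (1 + c₂ * Real.exp (-c₁ * θ))

/-- Position `U = (x, ‖x‖ tan θ)` of the UAV with ground projection `x`, elevation angle `θ`. -/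
def position (x : Plane) (θ : ℝ) : Space := WithLp.toLp 2 (x, ‖x‖ * Real.tan θ)

/-- The channel factor `L ∈ {1, ℓ}`: it is `1` on a line-of-sight link and `ℓ` otherwise. -/
def channelFactor (ℓ : ℝ) (los : Bool) : ℝ := if los = true then 1 else ℓ

/-- A UAV network in the angle-projection-independent locating (APIL) scenario. UAV `i` has ground
projection `X i`, elevation angle `Θ i`, fading gain `G i` (under beamforming with `N` antennas),
and `LoS i` tells whether its link to the origin is line-of-sight. `ν` is the common law of the
elevation angles, and `lam` is the density of the projections. -/
structure IsAPILNetwork {Ω : Type*} [MeasurableSpace Ω] (μ : Measure Ω)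
    (X : ℕ → Ω → Plane) (Θ : ℕ → Ω → ℝ) (LoS : ℕ → Ω → Bool) (G : ℕ → Ω → ℝ)
    (ν : Measure ℝ) (lam c₁ c₂ : ℝ) (N : ℕ) : Prop where
  /-- The projections form a homogeneous Poisson point process of density `lam`. -/
  projections : IsPoissonProcess X (ENNReal.ofReal lam • (volume : Measure Plane)) μ
  angle_measurable : ∀ i, Measurable (Θ i)
  los_measurable : ∀ i, Measurable (LoS i)
  gain_measurable : ∀ i, Measurable (G i)
  angle_law : ∀ i, HasLaw (Θ i) ν μ
  /-- Elevation angles lie in `[0, π/2)` almost surely, so that all altitudes are finite. -/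
  angle_mem : ∀ᵐ θ ∂ν, θ ∈ Set.Ico 0 (Real.pi / 2)
  /-- Given the elevation angle `θ`, a link is line-of-sight with probability `ρ(θ)`. -/
  los_law : ∀ i (B : Set ℝ), MeasurableSet B →
    μ {w | Θ i w ∈ B ∧ LoS i w = true} = ∫⁻ θ in B, ENNReal.ofReal (losProb c₁ c₂ θ) ∂ν
  /-- The pairs (elevation angle, line-of-sight indicator) of distinct UAVs are independent. -/
  mark_indep : iIndepFun (fun i w => (Θ i w, LoS i w)) μ
  /-- The elevation angles and line-of-sight indicators are independent of the projections. -/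
  mark_indep_projections :
    IndepFun (fun w i => (Θ i w, LoS i w)) (fun w i => X i w) μ
  /-- The fading gains are i.i.d. with law `Gamma(N, 1)`. -/
  gain_law : ∀ i, HasLaw (G i) (gammaMeasure N 1) μ
  gain_indep : iIndepFun G μ
  /-- The fading gains are independent of everything else. -/
  gain_indep_rest :
    IndepFun (fun w i => G i w) (fun w i => (X i w, Θ i w, LoS i w)) μ

/-- `S(w) = ∑ᵢ Gᵢ Lᵢ ‖Uᵢ‖^(-α) ∈ [0, ∞]`, the sum over all UAVs. -/
def shotSignal {Ω : Type*} (X : ℕ → Ω → Plane) (Θ : ℕ → Ω → ℝ) (LoS : ℕ → Ω → Bool)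
    (G : ℕ → Ω → ℝ) (α ℓ : ℝ) (w : Ω) : ℝ≥0∞ :=
  ∑' i, ENNReal.ofReal
    (G i w * channelFactor ℓ (LoS i w) * ‖position (X i w) (Θ i w)‖ ^ (-α))

/-- The cell-free downlink coverage `ℙ[P ∑ᵢ Gᵢ Lᵢ ‖Uᵢ‖^(-α) / σ₀ ≥ β]` under non-coherent joint
transmission from all UAVs. -/
def cellFreeCoverage {Ω : Type*} [MeasurableSpace Ω] (μ : Measure Ω)
    (X : ℕ → Ω → Plane) (Θ : ℕ → Ω → ℝ) (LoS : ℕ → Ω → Bool)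
    (G : ℕ → Ω → ℝ) (α ℓ P σ₀ β : ℝ) : ℝ :=
  μ.real {w | ENNReal.ofReal β ≤
    ENNReal.ofReal P * shotSignal X Θ LoS G α ℓ w / ENNReal.ofReal σ₀}

/-- `ω = 𝔼[cos²(Θ) (ρ(Θ) (1 - ℓ^(2/α)) + ℓ^(2/α))]`, where `Θ` has law `ν`. -/
def omega (ν : Measure ℝ) (c₁ c₂ α ℓ : ℝ) : ℝ :=
  ∫ θ, Real.cos θ ^ 2 *
    (losProb c₁ c₂ θ * (1 - ℓ ^ (2 / α)) + ℓ ^ (2 / α)) ∂ν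

/-- The value at `t` of the inverse Laplace transform of `F` is `v`: `F` is holomorphic on the
half-plane `Re s > a`, and for every `γ > a` the principal value of the Bromwich integral
`(2πi)⁻¹ ∫_{γ - i∞}^{γ + i∞} e^{st} F(s) ds` converges to `v`. -/
def HasInverseLaplaceAt (F : ℂ → ℂ) (a t : ℝ) (v : ℂ) : Prop :=
  DifferentiableOn ℂ F {s : ℂ | a < s.re} ∧
  ∀ γ : ℝ, a < γ → Tendsto
    (fun T : ℝ => (1 / (2 * (Real.pi : ℂ))) *
      ∫ y in (-T)..T, Complex.exp (((γ : ℂ) + y * Complex.I) * t) *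
        F ((γ : ℂ) + y * Complex.I))
    atTop (𝓝 v)

/-- The error function `erf z = (2/√π) ∫₀ᶻ e^{-t²} dt`. -/
def erf (z : ℝ) : ℝ := 2 / √Real.pi * ∫ t in (0 : ℝ)..z, Real.exp (-t ^ 2)

end

end UAV

/-!
Conditionally on the projections, the i.i.d. marks (elevation angle, line-of-sight indicator, fading
gain) average out of `exp (-s S)` point by point, and the Laplace functional of the planar Poisson
process gives `𝔼 exp (-s S) = exp (-λ ∫ (1 - 𝔼 exp (-s G L ‖U‖^(-α))) dx)`. Since
`‖U‖ = ‖x‖ / cos Θ`, the radial integral is homogeneous of degree `2 / α` in `s G L cos^α Θ`, and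
averaging over the marks gives `exp (-K s^(2/α))`: the received signal is one-sided stable.

The transform of the distribution function is then `s⁻¹ exp (-K s^(2/α))` on the whole right
half-plane by analytic continuation. It is integrable along vertical lines, so Fourier inversion
represents the distribution function by a continuous Bromwich integral off its countable set of
jumps, hence everywhere by monotonicity. For `α = 4` the index is `1 / 2`, and `(K / (2 Z))²` with
`Z` Gaussian has the same transform, hence the same distribution function.
-/

namespace UAV

/-- `e^{-x}` for `x ∈ [0, ∞]`, with `e^{-∞} = 0`. -/
noncomputable def expNeg (x : ℝ≥0∞) : ℝ≥0∞ := EReal.exp (-(x : EReal))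

@[simp] lemma expNeg_zero : expNeg 0 = 1 := by simp [expNeg]

@[simp] lemma expNeg_top : expNeg ∞ = 0 := by simp [expNeg]

lemma expNeg_add (x y : ℝ≥0∞) : expNeg (x + y) = expNeg x * expNeg y := by
  have hneg : -((x : EReal) + (y : EReal)) = -(x : EReal) + -(y : EReal) := by
    rw [EReal.neg_add (Or.inl (by simp)) (Or.inr (by simp)), sub_eq_add_neg]
  rw [expNeg, EReal.coe_ennreal_add, hneg, EReal.exp_add, expNeg, expNeg]

lemma expNeg_ofReal {x : ℝ} (hx : 0 ≤ x) :
    expNeg (ENNReal.ofReal x) = ENNReal.ofReal (Real.exp (-x)) := by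
  rw [expNeg, EReal.coe_ennreal_ofReal, max_eq_left hx, ← EReal.coe_neg, EReal.exp_coe]

lemma expNeg_of_ne_top {x : ℝ≥0∞} (hx : x ≠ ∞) :
    expNeg x = ENNReal.ofReal (Real.exp (-x.toReal)) := by
  rw [← expNeg_ofReal ENNReal.toReal_nonneg, ENNReal.ofReal_toReal hx]

lemma antitone_expNeg : Antitone expNeg := fun _ _ h =>
  EReal.exp_monotone (EReal.neg_le_neg_iff.2 (by exact_mod_cast h))

lemma expNeg_le_one (x : ℝ≥0∞) : expNeg x ≤ 1 := by
  simpa only [expNeg_zero] using antitone_expNeg (zero_le (a := x))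

lemma expNeg_ne_top (x : ℝ≥0∞) : expNeg x ≠ ∞ :=
  ((expNeg_le_one x).trans_lt ENNReal.one_lt_top).ne

@[fun_prop] lemma continuous_expNeg : Continuous expNeg :=
  ENNReal.continuous_exp.comp (continuous_neg.comp continuous_coe_ennreal_ereal)

@[fun_prop] lemma measurable_expNeg : Measurable expNeg := continuous_expNeg.measurable

lemma expNeg_sum {ι : Type*} (s : Finset ι) (a : ι → ℝ≥0∞) :
    expNeg (∑ i ∈ s, a i) = ∏ i ∈ s, expNeg (a i) := by
  classical
  induction s using Finset.induction_on with
  | empty => simp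
  | insert i s hi ih => rw [Finset.sum_insert hi, Finset.prod_insert hi, expNeg_add, ih]

lemma expNeg_mul_natCast (a : ℝ≥0∞) (n : ℕ) : expNeg (a * n) = expNeg a ^ n := by
  rw [mul_comm, ← nsmul_eq_mul, ← Fin.sum_const, expNeg_sum, Fin.prod_const]

/-- `-log y ∈ [0, ∞]` for `y ∈ [0, 1]`. -/
noncomputable def negLog (y : ℝ≥0∞) : ℝ≥0∞ := (-ENNReal.log y).toENNReal

lemma expNeg_negLog {y : ℝ≥0∞} (hy : y ≤ 1) : expNeg (negLog y) = y := by
  have hlog : 0 ≤ -ENNReal.log y := EReal.neg_nonneg.2 (ENNReal.log_le_zero_iff.2 hy)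
  rw [expNeg, negLog, EReal.coe_toENNReal hlog, neg_neg, ENNReal.exp_log]

@[fun_prop] lemma measurable_negLog : Measurable negLog :=
  measurable_ereal_toENNReal.comp (continuous_neg.measurable.comp ENNReal.measurable_log)

section LaplaceExponent

variable {A : Type*} [MeasurableSpace A]

/-- The Laplace exponent `-log ∫ e^{-h} dη ∈ [0, ∞]`: the deterministic quantity that replaces a
random `h` when it is averaged out of an exponential. -/
noncomputable def laplaceExponent (η : Measure A) (h : A → ℝ≥0∞) : ℝ≥0∞ :=
  negLog (∫⁻ a, expNeg (h a) ∂η)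

lemma lintegral_expNeg_le_one (η : Measure A) [IsProbabilityMeasure η] (h : A → ℝ≥0∞) :
    ∫⁻ a, expNeg (h a) ∂η ≤ 1 :=
  (lintegral_mono fun a => expNeg_le_one (h a)).trans (by simp)

lemma expNeg_laplaceExponent (η : Measure A) [IsProbabilityMeasure η] (h : A → ℝ≥0∞) :
    expNeg (laplaceExponent η h) = ∫⁻ a, expNeg (h a) ∂η :=
  expNeg_negLog (lintegral_expNeg_le_one η h)

lemma one_sub_lintegral_expNeg {η : Measure A} [IsProbabilityMeasure η] {h : A → ℝ≥0∞}
    (hh : Measurable h) : 1 - ∫⁻ a, expNeg (h a) ∂η = ∫⁻ a, (1 - expNeg (h a)) ∂η := by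
  rw [lintegral_sub (by fun_prop)
    ((lintegral_expNeg_le_one η h).trans_lt ENNReal.one_lt_top).ne
    (ae_of_all _ fun a => expNeg_le_one _), lintegral_one, measure_univ]

lemma measurable_laplaceExponent {B : Type*} [MeasurableSpace B] {η : Measure A} [SFinite η]
    {h : B × A → ℝ≥0∞} (hh : Measurable h) :
    Measurable fun b => laplaceExponent η fun a => h (b, a) :=
  measurable_negLog.comp (measurable_expNeg.comp hh).lintegral_prod_right'

end LaplaceExponent

lemma lintegral_pow_poissonMeasure (r q : ℝ≥0) :
    ∫⁻ n, (q : ℝ≥0∞) ^ n ∂poissonMeasure r = ENNReal.ofReal (Real.exp (-(r * (1 - q)))) := by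
  have hterm : ∀ n : ℕ, (q : ℝ≥0∞) ^ n * poissonMeasure r {n} =
      ENNReal.ofReal (Real.exp (-r) * ((r * q : ℝ) ^ n / n.factorial)) := fun n => by
    rw [poissonMeasure_singleton, ← ENNReal.ofReal_coe_nnreal, ← ENNReal.ofReal_pow q.coe_nonneg,
      ← ENNReal.ofReal_mul (by positivity)]
    congr 1
    ring
  have hexp := (NormedSpace.expSeries_div_hasSum_exp (r * q : ℝ)).mul_left (Real.exp (-r))
  rw [← Real.exp_eq_exp_ℝ, ← Real.exp_add] at hexp
  rw [lintegral_countable']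
  simp_rw [hterm]
  rw [← ENNReal.ofReal_tsum_of_nonneg (fun n => by positivity) hexp.summable, hexp.tsum_eq]
  congr 2
  ring

lemma lintegral_expNeg_poissonMeasure (r : ℝ≥0) (a : ℝ≥0∞) :
    ∫⁻ n : ℕ, expNeg (a * n) ∂poissonMeasure r = expNeg (r * (1 - expNeg a)) := by
  lift expNeg a to ℝ≥0 using expNeg_ne_top a with q hq
  have hq1 : q ≤ 1 := by exact_mod_cast hq ▸ expNeg_le_one a
  simp_rw [expNeg_mul_natCast, ← hq]
  rw [lintegral_pow_poissonMeasure, ← expNeg_ofReal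
    (mul_nonneg r.coe_nonneg (sub_nonneg.2 (by exact_mod_cast hq1))),
    ENNReal.ofReal_mul r.coe_nonneg, ENNReal.ofReal_sub _ q.coe_nonneg, ENNReal.ofReal_one,
    ENNReal.ofReal_coe_nnreal, ENNReal.ofReal_coe_nnreal]

section PointMeasure

variable {Ω E : Type*} [MeasurableSpace E] {X : ℕ → Ω → E}

/-- The random counting measure `∑ᵢ δ_{X i}` of a point configuration, so that sums over the points
become integrals. -/
noncomputable def pointMeasure (X : ℕ → Ω → E) (w : Ω) : Measure E :=
  Measure.sum fun i => Measure.dirac (X i w)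

lemma lintegral_pointMeasure {u : E → ℝ≥0∞} (hu : Measurable u) (w : Ω) :
    ∫⁻ x, u x ∂pointMeasure X w = ∑' i, u (X i w) := by
  simp_rw [pointMeasure, lintegral_sum_measure, lintegral_dirac' _ hu]

lemma pointMeasure_apply {B : Set E} (hB : MeasurableSet B) (w : Ω) :
    pointMeasure X w B = (count X B w : ℝ≥0∞) := by
  rw [← lintegral_indicator_one hB, lintegral_pointMeasure (measurable_one.indicator hB), count,
    ← ENNReal.tsum_set_one, tsum_subtype {i | X i w ∈ B} fun _ => (1 : ℝ≥0∞)]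
  rfl

lemma measurable_lintegral_pointMeasure [MeasurableSpace Ω] (hX : ∀ i, Measurable (X i))
    {u : E → ℝ≥0∞} (hu : Measurable u) : Measurable fun w => ∫⁻ x, u x ∂pointMeasure X w := by
  simp_rw [lintegral_pointMeasure hu]
  exact Measurable.tsum fun i => hu.comp (hX i)

end PointMeasure

section SimpleFunc

variable {E : Type*} [MeasurableSpace E]

lemma lintegral_comp_simpleFunc {g : ℝ≥0∞ → ℝ≥0∞} (hg : g 0 = 0) (f : SimpleFunc E ℝ≥0∞)
    (ν : Measure E) :
    ∫⁻ x, g (f x) ∂ν = ∑ a : {a // a ∈ f.range.erase 0}, g a * ν (f ⁻¹' {(a : ℝ≥0∞)}) := by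
  rw [Finset.sum_coe_sort (f.range.erase 0) fun a => g a * ν (f ⁻¹' {a}),
    Finset.sum_erase _ (by rw [hg, zero_mul]), ← SimpleFunc.map_lintegral,
    ← SimpleFunc.lintegral_eq_lintegral]
  rfl

lemma exists_monotone_tendsto_finMeasSupp (ν : Measure E) [SigmaFinite ν] {u : E → ℝ≥0∞}
    (hu : Measurable u) :
    ∃ f : ℕ → SimpleFunc E ℝ≥0∞, (∀ n, (f n).FinMeasSupp ν) ∧
      (∀ x, Monotone fun n => f n x) ∧ ∀ x, Tendsto (fun n => f n x) atTop (𝓝 (u x)) := by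
  set f : ℕ → SimpleFunc E ℝ≥0∞ := fun n =>
    (SimpleFunc.eapprox u n).restrict (spanningSets ν n)
  have hf : ∀ n x, f n x = (spanningSets ν n).indicator (SimpleFunc.eapprox u n) x :=
    fun n x => SimpleFunc.restrict_apply _ (measurableSet_spanningSets ν n) x
  refine ⟨f, fun n => ?_, fun x n m hnm => ?_, fun x => ?_⟩
  · rw [SimpleFunc.finMeasSupp_iff_support]
    refine (measure_mono fun x hx => ?_).trans_lt (measure_spanningSets_lt_top ν n)
    rw [Function.mem_support, hf] at hx
    exact Set.mem_of_indicator_ne_zero hx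
  · simp only [hf]
    exact (Set.indicator_le_indicator_of_subset (monotone_spanningSets ν hnm)
      (fun _ => zero_le) x).trans (Set.indicator_le_indicator (SimpleFunc.monotone_eapprox u hnm x))
  · refine (SimpleFunc.tendsto_eapprox hu x).congr' ?_
    filter_upwards [eventually_ge_atTop (spanningSetsIndex ν x)] with n hn
    rw [hf, Set.indicator_of_mem (mem_spanningSets_of_index_le ν x hn)]

end SimpleFunc

namespace IsPoissonProcess

variable {Ω E : Type*} [MeasurableSpace Ω] [MeasurableSpace E] {X : ℕ → Ω → E} {Λ : Measure E}
  {μ : Measure Ω}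

lemma lintegral_expNeg_mul_count (hX : IsPoissonProcess X Λ μ) {B : Set E}
    (hB : MeasurableSet B) (hΛ : Λ B < ∞) (a : ℝ≥0∞) :
    ∫⁻ w, expNeg (a * (count X B w : ℝ≥0∞)) ∂μ = expNeg (Λ B * (1 - expNeg a)) := by
  have hlaw := hX.count_law B hB hΛ
  have hm : Measurable fun n : ℕ∞ => expNeg (a * (n : ℝ≥0∞)) := measurable_of_countable _
  rw [← lintegral_map' (f := fun n : ℕ∞ => expNeg (a * (n : ℝ≥0∞))) hm.aemeasurable
    hlaw.aemeasurable, hlaw.map_eq, lintegral_map hm (measurable_of_countable _)]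
  simp only [ENat.toENNReal_coe]
  rw [lintegral_expNeg_poissonMeasure, ENNReal.coe_toNNReal hΛ.ne]

lemma iIndepFun_count (hX : IsPoissonProcess X Λ μ) {ι : Type*} [Finite ι] {B : ι → Set E}
    (hB : ∀ j, MeasurableSet (B j)) (hΛ : ∀ j, Λ (B j) < ∞)
    (hdisj : Pairwise fun j k => Disjoint (B j) (B k)) :
    iIndepFun (fun j => count X (B j)) μ := by
  let e := Finite.equivFin ι
  have hfin := hX.count_indep (Nat.card ι) (fun j => B (e.symm j)) (fun j => hB _)
    (fun j => hΛ _) fun j k hjk => hdisj (e.symm.injective.ne hjk)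
  simpa only [Equiv.symm_apply_apply] using hfin.precomp e.injective

lemma lintegral_expNeg_sum_mul_count (hX : IsPoissonProcess X Λ μ) {ι : Type*} [Fintype ι]
    {B : ι → Set E} (hB : ∀ j, MeasurableSet (B j)) (hΛ : ∀ j, Λ (B j) < ∞)
    (hdisj : Pairwise fun j k => Disjoint (B j) (B k)) (a : ι → ℝ≥0∞) :
    ∫⁻ w, expNeg (∑ j, a j * (count X (B j) w : ℝ≥0∞)) ∂μ =
      expNeg (∑ j, Λ (B j) * (1 - expNeg (a j))) := by
  have hind : iIndepFun (fun j w => expNeg (a j * (count X (B j) w : ℝ≥0∞))) μ :=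
    (hX.iIndepFun_count hB hΛ hdisj).comp (fun j n => expNeg (a j * ((n : ℕ∞) : ℝ≥0∞)))
      fun j => measurable_of_countable _
  have hmeas : ∀ j, Measurable fun w => expNeg (a j * (count X (B j) w : ℝ≥0∞)) := fun j => by
    simp_rw [← pointMeasure_apply (hB j), ← lintegral_indicator_one (hB j)]
    exact measurable_expNeg.comp ((measurable_lintegral_pointMeasure hX.measurable
      (measurable_one.indicator (hB j))).const_mul _)
  simp_rw [expNeg_sum]
  rw [lintegral_prod_eq_prod_lintegral_of_indepFun _ _ hind hmeas]
  exact Finset.prod_congr rfl fun j _ => hX.lintegral_expNeg_mul_count (hB j) (hΛ j) (a j)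

lemma laplaceFunctional_simpleFunc (hX : IsPoissonProcess X Λ μ) {f : SimpleFunc E ℝ≥0∞}
    (hf : f.FinMeasSupp Λ) :
    ∫⁻ w, expNeg (∫⁻ x, f x ∂pointMeasure X w) ∂μ = expNeg (∫⁻ x, (1 - expNeg (f x)) ∂Λ) := by
  have hmeas : ∀ a : {a // a ∈ f.range.erase 0}, MeasurableSet (f ⁻¹' {(a : ℝ≥0∞)}) :=
    fun a => f.measurableSet_fiber a
  rw [lintegral_comp_simpleFunc (g := fun a => 1 - expNeg a) (by simp) f Λ]
  have hsum : ∀ w, ∫⁻ x, f x ∂pointMeasure X w =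
      ∑ a : {a // a ∈ f.range.erase 0}, a * (count X (f ⁻¹' {(a : ℝ≥0∞)}) w : ℝ≥0∞) := fun w => by
    simp_rw [← pointMeasure_apply (hmeas _)]
    exact lintegral_comp_simpleFunc (g := id) rfl f _
  simp_rw [hsum, mul_comm (1 - expNeg _)]
  refine hX.lintegral_expNeg_sum_mul_count hmeas
    (fun a => hf.meas_preimage_singleton_ne_zero (Finset.ne_of_mem_erase a.2))
    (fun a b hab => ?_) _
  exact Disjoint.preimage _ (Set.disjoint_singleton.2 (Subtype.coe_injective.ne hab))

theorem laplaceFunctional [IsProbabilityMeasure μ] [SigmaFinite Λ]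
    (hX : IsPoissonProcess X Λ μ) {u : E → ℝ≥0∞} (hu : Measurable u) :
    ∫⁻ w, expNeg (∑' i, u (X i w)) ∂μ = expNeg (∫⁻ x, (1 - expNeg (u x)) ∂Λ) := by
  obtain ⟨f, hfin, hmono, htend⟩ := exists_monotone_tendsto_finMeasSupp Λ hu
  simp_rw [← lintegral_pointMeasure hu]
  have hleft : Tendsto (fun n => ∫⁻ w, expNeg (∫⁻ x, f n x ∂pointMeasure X w) ∂μ) atTop
      (𝓝 (∫⁻ w, expNeg (∫⁻ x, u x ∂pointMeasure X w) ∂μ)) := by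
    refine tendsto_lintegral_of_dominated_convergence (fun _ => 1) (fun n => ?_)
      (fun n => ae_of_all _ fun w => expNeg_le_one _) (by simp) (ae_of_all _ fun w => ?_)
    · exact measurable_expNeg.comp
        (measurable_lintegral_pointMeasure hX.measurable (f n).measurable)
    · exact (continuous_expNeg.tendsto _).comp (lintegral_tendsto_of_tendsto_of_monotone
        (fun n => (f n).measurable.aemeasurable) (ae_of_all _ hmono) (ae_of_all _ htend))
  have hright : Tendsto (fun n => expNeg (∫⁻ x, (1 - expNeg (f n x)) ∂Λ)) atTop
      (𝓝 (expNeg (∫⁻ x, (1 - expNeg (u x)) ∂Λ))) := by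
    refine (continuous_expNeg.tendsto _).comp (lintegral_tendsto_of_tendsto_of_monotone
      (fun n => ?_) (ae_of_all _ fun x n m h => ?_) (ae_of_all _ fun x => ?_))
    · exact (measurable_const.sub (measurable_expNeg.comp (f n).measurable)).aemeasurable
    · exact tsub_le_tsub_left (antitone_expNeg (hmono x h)) _
    · exact ENNReal.Tendsto.sub tendsto_const_nhds ((continuous_expNeg.tendsto _).comp (htend x))
        (Or.inl ENNReal.one_ne_top)
  exact tendsto_nhds_unique hleft
    (hright.congr fun n => (hX.laplaceFunctional_simpleFunc (hfin n)).symm)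

end IsPoissonProcess

section Marks

variable {Ω A B : Type*} [MeasurableSpace Ω] [MeasurableSpace A] [MeasurableSpace B]
  {μ : Measure Ω} {V : ℕ → Ω → A} {W : ℕ → Ω → B} {η : Measure A}

lemma tendsto_lintegral_prod_expNeg [IsFiniteMeasure μ] {a : ℕ → Ω → ℝ≥0∞}
    (ha : ∀ i, Measurable (a i)) :
    Tendsto (fun n => ∫⁻ w, ∏ i ∈ Finset.range n, expNeg (a i w) ∂μ) atTop
      (𝓝 (∫⁻ w, expNeg (∑' i, a i w) ∂μ)) := by
  refine tendsto_lintegral_of_dominated_convergence (fun _ => 1) (fun n => by fun_prop)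
    (fun n => ae_of_all _ fun w => Finset.prod_le_one' fun i _ => expNeg_le_one _) (by simp)
    (ae_of_all _ fun w => ?_)
  simp_rw [← expNeg_sum]
  exact (continuous_expNeg.tendsto _).comp ENNReal.summable.hasSum.tendsto_sum_nat

theorem lintegral_prod_iid_marks (hVm : ∀ i, Measurable (V i)) (hWm : ∀ i, Measurable (W i))
    (hV : iIndepFun V μ) (hlaw : ∀ i, HasLaw (V i) η μ)
    (hVW : IndepFun (fun w i => V i w) (fun w i => W i w) μ)
    {h : B × A → ℝ≥0∞} (hh : Measurable h) (s : Finset ℕ) :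
    ∫⁻ w, ∏ i ∈ s, h (W i w, V i w) ∂μ = ∫⁻ w, ∏ i ∈ s, ∫⁻ a, h (W i w, a) ∂η ∂μ := by
  have := hV.isProbabilityMeasure
  have hVm' : Measurable fun w i => V i w := measurable_pi_lambda _ hVm
  have hWm' : Measurable fun w i => W i w := measurable_pi_lambda _ hWm
  have hη : SFinite η := by
    rw [← (hlaw 0).map_eq]
    infer_instance
  have hprod : Measurable fun p : (ℕ → A) × (ℕ → B) => ∏ i ∈ s, h (p.2 i, p.1 i) := by fun_prop
  have hfix : ∀ b : ℕ → B, ∫⁻ v, ∏ i ∈ s, h (b i, v i) ∂(μ.map fun w i => V i w) =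
      ∏ i ∈ s, ∫⁻ a, h (b i, a) ∂η := fun b => by
    rw [lintegral_map (by fun_prop) hVm', lintegral_prod_eq_prod_lintegral_of_indepFun s
      (fun i w => h (b i, V i w)) (hV.comp (fun i a => h (b i, a)) fun i => by fun_prop)
      fun i => by fun_prop]
    refine Finset.prod_congr rfl fun i _ => ?_
    rw [← (hlaw i).map_eq, lintegral_map (by fun_prop) (hVm i)]
  calc ∫⁻ w, ∏ i ∈ s, h (W i w, V i w) ∂μ
      = ∫⁻ p, ∏ i ∈ s, h (p.2 i, p.1 i) ∂(μ.map fun w => (fun i => V i w, fun i => W i w)) := by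
        rw [lintegral_map hprod (hVm'.prodMk hWm')]
    _ = ∫⁻ b, ∫⁻ v, ∏ i ∈ s, h (b i, v i) ∂(μ.map fun w i => V i w)
          ∂(μ.map fun w i => W i w) := by
        rw [(indepFun_iff_map_prod_eq_prod_map_map hVm'.aemeasurable hWm'.aemeasurable).1 hVW,
          lintegral_prod_symm _ hprod.aemeasurable]
    _ = ∫⁻ w, ∏ i ∈ s, ∫⁻ a, h (W i w, a) ∂η ∂μ := by
        simp_rw [hfix]
        exact lintegral_map (Finset.measurable_prod _ fun i _ =>
          hh.lintegral_prod_right'.comp (measurable_pi_apply i)) hWm'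

theorem lintegral_expNeg_tsum_iid_marks [IsProbabilityMeasure η]
    (hVm : ∀ i, Measurable (V i)) (hWm : ∀ i, Measurable (W i)) (hV : iIndepFun V μ)
    (hlaw : ∀ i, HasLaw (V i) η μ) (hVW : IndepFun (fun w i => V i w) (fun w i => W i w) μ)
    {h : B × A → ℝ≥0∞} (hh : Measurable h) :
    ∫⁻ w, expNeg (∑' i, h (W i w, V i w)) ∂μ =
      ∫⁻ w, expNeg (∑' i, laplaceExponent η fun a => h (W i w, a)) ∂μ := by
  have := hV.isProbabilityMeasure
  have hmarked := tendsto_lintegral_prod_expNeg (μ := μ)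
    fun i => hh.comp ((hWm i).prodMk (hVm i))
  have haveraged := tendsto_lintegral_prod_expNeg (μ := μ)
    fun i => (measurable_laplaceExponent (η := η) hh).comp (hWm i)
  refine tendsto_nhds_unique hmarked (haveraged.congr fun n => ?_)
  simp_rw [Function.comp_apply, expNeg_laplaceExponent]
  exact (lintegral_prod_iid_marks hVm hWm hV hlaw hVW (measurable_expNeg.comp hh) _).symm

theorem IsPoissonProcess.laplaceFunctional_marked [IsProbabilityMeasure η] {X : ℕ → Ω → B}
    {Λ : Measure B} [SigmaFinite Λ] (hX : IsPoissonProcess X Λ μ) (hVm : ∀ i, Measurable (V i))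
    (hV : iIndepFun V μ) (hlaw : ∀ i, HasLaw (V i) η μ)
    (hVX : IndepFun (fun w i => V i w) (fun w i => X i w) μ)
    {h : B × A → ℝ≥0∞} (hh : Measurable h) :
    ∫⁻ w, expNeg (∑' i, h (X i w, V i w)) ∂μ =
      expNeg (∫⁻ x, ∫⁻ a, (1 - expNeg (h (x, a))) ∂η ∂Λ) := by
  have := hV.isProbabilityMeasure
  rw [lintegral_expNeg_tsum_iid_marks hVm hX.measurable hV hlaw hVX hh,
    hX.laplaceFunctional (measurable_laplaceExponent hh)]
  simp_rw [expNeg_laplaceExponent]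
  exact congrArg expNeg (lintegral_congr fun x => one_sub_lintegral_expNeg (by fun_prop))

end Marks

lemma lintegral_rpow_mul_exp_neg_mul {a r : ℝ} (ha : 0 < a) (hr : 0 < r) :
    ∫⁻ t in Set.Ioi (0 : ℝ), ENNReal.ofReal (t ^ (a - 1) * Real.exp (-(r * t))) =
      ENNReal.ofReal ((1 / r) ^ a * Real.Gamma a) := by
  have hval := Real.integral_rpow_mul_exp_neg_mul_Ioi ha hr
  rw [← hval, ofReal_integral_eq_lintegral_ofReal (Integrable.of_integral_ne_zero (by
    rw [hval]; positivity))]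
  filter_upwards [ae_restrict_mem measurableSet_Ioi] with t ht
  exact mul_nonneg (Real.rpow_nonneg (Set.mem_Ioi.1 ht).le _) (Real.exp_pos _).le

section GammaMoments

@[fun_prop] lemma measurable_gammaPDF (a r : ℝ) : Measurable (gammaPDF a r) :=
  (measurable_gammaPDFReal a r).ennreal_ofReal

lemma ae_pos_gammaMeasure (a r : ℝ) : ∀ᵐ g ∂gammaMeasure a r, 0 < g := by
  rw [gammaMeasure, ae_withDensity_iff (measurable_gammaPDF a r)]
  filter_upwards [volume.ae_ne (0 : ℝ)] with g hg hpdf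
  exact (le_of_not_gt fun hneg => hpdf (gammaPDF_of_neg hneg)).lt_of_ne' hg

theorem lintegral_rpow_gammaMeasure {a r δ : ℝ} (ha : 0 < a) (hr : 0 < r) (hδ : 0 < a + δ) :
    ∫⁻ g, ENNReal.ofReal (g ^ δ) ∂gammaMeasure a r =
      ENNReal.ofReal (Real.Gamma (a + δ) / (Real.Gamma a * r ^ δ)) := by
  have hdensity : ∀ g ∈ Set.Ioi (0 : ℝ), (gammaPDF a r * fun g => ENNReal.ofReal (g ^ δ)) g =
      ENNReal.ofReal (r ^ a / Real.Gamma a) *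
        ENNReal.ofReal (g ^ (a + δ - 1) * Real.exp (-(r * g))) := fun g hg => by
    have hg0 : 0 < g := hg
    rw [Pi.mul_apply, gammaPDF_of_nonneg hg0.le, ← ENNReal.ofReal_mul (by positivity),
      ← ENNReal.ofReal_mul (by positivity), add_sub_right_comm, Real.rpow_add hg0]
    ring_nf
  rw [← Measure.restrict_eq_self_of_ae_mem (s := Set.Ioi 0) (ae_pos_gammaMeasure a r),
    gammaMeasure, restrict_withDensity measurableSet_Ioi, lintegral_withDensity_eq_lintegral_mul _
      (measurable_gammaPDF a r) (by fun_prop),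
    setLIntegral_congr_fun measurableSet_Ioi hdensity, lintegral_const_mul _ (by fun_prop),
    lintegral_rpow_mul_exp_neg_mul hδ hr, ← ENNReal.ofReal_mul (by positivity),
    one_div, Real.inv_rpow hr.le, Real.rpow_add hr]
  congr 1
  field_simp

end GammaMoments

section PowerLaw

variable {E : Type*} [NormedAddCommGroup E] [NormedSpace ℝ E] [FiniteDimensional ℝ E]
  [Nontrivial E] [MeasurableSpace E] [BorelSpace E] (μ : Measure E) [μ.IsAddHaarMeasure]

lemma addHaar_lt_mul_norm_rpow_neg {α c r : ℝ} (hα : 0 < α) (hc : 0 < c) (hr : 0 < r) :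
    μ {x : E | r < c * ‖x‖ ^ (-α)} =
      ENNReal.ofReal ((c / r) ^ (Module.finrank ℝ E / α)) * μ (Metric.ball 0 1) := by
  have hset : {x : E | r < c * ‖x‖ ^ (-α)} = Metric.ball 0 ((c / r) ^ α⁻¹) \ {0} := by
    ext x
    simp only [Set.mem_ofPred_eq, Set.mem_sdiff, Metric.mem_ball, dist_zero_right,
      Set.mem_singleton_iff]
    rcases eq_or_ne x 0 with rfl | hx
    · simp [Real.zero_rpow (neg_ne_zero.2 hα.ne'), hr.le]
    · have hn : 0 < ‖x‖ := norm_pos_iff.2 hx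
      rw [Real.lt_rpow_inv_iff_of_pos hn.le (by positivity) hα, Real.rpow_neg hn.le,
        lt_div_iff₀ hr, ← div_eq_mul_inv, lt_div_iff₀ (by positivity), mul_comm]
      simp [hx]
  rw [hset, measure_sdiff_null (measure_singleton 0), μ.addHaar_ball 0 (by positivity),
    ← Real.rpow_natCast, ← Real.rpow_mul (by positivity), inv_mul_eq_div]

lemma one_sub_expNeg_ofReal {u : ℝ} (hu : 0 ≤ u) :
    1 - expNeg (ENNReal.ofReal u) = ENNReal.ofReal (∫ t in (0 : ℝ)..u, Real.exp (-t)) := by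
  rw [expNeg_ofReal hu, ← ENNReal.ofReal_one, ← ENNReal.ofReal_sub _ (Real.exp_pos _).le,
    intervalIntegral.integral_comp_neg fun t => Real.exp t, integral_exp, neg_zero, Real.exp_zero]

theorem lintegral_one_sub_expNeg_mul_norm_rpow_neg {α c : ℝ} (hα : Module.finrank ℝ E < α)
    (hc : 0 ≤ c) :
    ∫⁻ x, (1 - expNeg (ENNReal.ofReal (c * ‖x‖ ^ (-α)))) ∂μ =
      ENNReal.ofReal (c ^ (Module.finrank ℝ E / α) * Real.Gamma (1 - Module.finrank ℝ E / α)) *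
        μ (Metric.ball 0 1) := by
  have hd : (0 : ℝ) < Module.finrank ℝ E := by exact_mod_cast Module.finrank_pos
  have hα0 : 0 < α := hd.trans hα
  set δ := Module.finrank ℝ E / α
  have hδ : 0 < 1 - δ := sub_pos.2 ((div_lt_one hα0).2 hα)
  rcases hc.eq_or_lt with rfl | hc
  · simp [Real.zero_rpow (show δ ≠ 0 by positivity)]
  have hlevel : ∀ r ∈ Set.Ioi (0 : ℝ),
      μ {x : E | r < c * ‖x‖ ^ (-α)} * ENNReal.ofReal (Real.exp (-r)) =
        ENNReal.ofReal (c ^ δ) * μ (Metric.ball 0 1) *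
          ENNReal.ofReal (r ^ (1 - δ - 1) * Real.exp (-(1 * r))) := fun r hr => by
    have hr0 : 0 < r := hr
    rw [addHaar_lt_mul_norm_rpow_neg μ hα0 hc hr0, mul_right_comm,
      mul_right_comm (ENNReal.ofReal (c ^ δ)), ← ENNReal.ofReal_mul (by positivity),
      ← ENNReal.ofReal_mul (by positivity), Real.div_rpow hc.le hr0.le, one_mul,
      sub_sub_cancel_left, Real.rpow_neg hr0.le, div_eq_mul_inv, mul_assoc]
  simp_rw [fun x : E => one_sub_expNeg_ofReal (show 0 ≤ c * ‖x‖ ^ (-α) by positivity)]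
  rw [lintegral_comp_eq_lintegral_meas_lt_mul μ (ae_of_all _ fun x => by positivity)
      (by fun_prop) (fun t _ => Continuous.intervalIntegrable (by fun_prop) _ _)
      (ae_of_all _ fun t => (Real.exp_pos _).le),
    setLIntegral_congr_fun measurableSet_Ioi hlevel, lintegral_const_mul _ (by fun_prop),
    lintegral_rpow_mul_exp_neg_mul hδ one_pos, mul_right_comm,
    ← ENNReal.ofReal_mul (by positivity)]
  simp

end PowerLaw

section Geometry

/-- The power received from a UAV with projection `x`, elevation angle `m.1`, line-of-sight
indicator `m.2` and channel gain `g`. -/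
noncomputable def receivedPower (α ℓ : ℝ) (x : Plane) (m : ℝ × Bool) (g : ℝ) : ℝ≥0∞ :=
  ENNReal.ofReal (g * channelFactor ℓ m.2 * ‖position x m.1‖ ^ (-α))

lemma channelFactor_nonneg {ℓ : ℝ} (hℓ : 0 ≤ ℓ) (b : Bool) : 0 ≤ channelFactor ℓ b := by
  unfold channelFactor
  split_ifs <;> linarith

lemma norm_position_sq (x : Plane) (θ : ℝ) :
    ‖position x θ‖ ^ 2 = ‖x‖ ^ 2 + (‖x‖ * Real.tan θ) ^ 2 := by
  rw [position, WithLp.prod_norm_sq_eq_of_L2, Real.norm_eq_abs, sq_abs]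
  rfl

lemma norm_position (x : Plane) {θ : ℝ} (hθ : 0 < Real.cos θ) :
    ‖position x θ‖ = ‖x‖ / Real.cos θ := by
  rw [← sq_eq_sq₀ (norm_nonneg _) (by positivity), norm_position_sq, Real.tan_eq_sin_div_cos]
  field_simp
  linear_combination ‖x‖ ^ 2 * Real.cos_sq_add_sin_sq θ

lemma measurable_norm_position : Measurable fun p : Plane × ℝ => ‖position p.1 p.2‖ := by
  have hsqrt : (fun p : Plane × ℝ => ‖position p.1 p.2‖) =
      fun p => √(‖p.1‖ ^ 2 + (‖p.1‖ * (Real.sin p.2 / Real.cos p.2)) ^ 2) := by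
    funext p
    rw [← Real.sqrt_sq (norm_nonneg (position _ _)), norm_position_sq, Real.tan_eq_sin_div_cos]
  rw [hsqrt]
  fun_prop

lemma measurable_receivedPower (α ℓ : ℝ) :
    Measurable fun p : (Plane × (ℝ × Bool)) × ℝ => receivedPower α ℓ p.1.1 p.1.2 p.2 := by
  have hnorm : Measurable fun p : (Plane × (ℝ × Bool)) × ℝ => ‖position p.1.1 p.1.2.1‖ :=
    measurable_norm_position.comp (f := fun p : (Plane × (ℝ × Bool)) × ℝ => (p.1.1, p.1.2.1))
      (by fun_prop)
  unfold receivedPower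
  fun_prop

lemma cos_pos_of_mem_Ico {θ : ℝ} (hθ : θ ∈ Set.Ico 0 (Real.pi / 2)) : 0 < Real.cos θ :=
  Real.cos_pos_of_mem_Ioo ⟨by linarith [hθ.1, Real.pi_pos], hθ.2⟩

lemma lintegral_one_sub_expNeg_receivedPower {α ℓ s g θ : ℝ} (hα : 2 < α) (hℓ : 0 ≤ ℓ)
    (hs : 0 ≤ s) (hg : 0 ≤ g) (hθ : θ ∈ Set.Ico 0 (Real.pi / 2)) (b : Bool) :
    ∫⁻ x : Plane, (1 - expNeg (ENNReal.ofReal s * receivedPower α ℓ x (θ, b) g)) =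
      ENNReal.ofReal (Real.pi * s ^ (2 / α) * Real.Gamma (1 - 2 / α)) *
        (ENNReal.ofReal (Real.cos θ ^ 2 * channelFactor ℓ b ^ (2 / α)) *
          ENNReal.ofReal (g ^ (2 / α))) := by
  have hcos := cos_pos_of_mem_Ico hθ
  have hL := channelFactor_nonneg hℓ b
  have hΓ : 0 < Real.Gamma (1 - 2 / α) :=
    Real.Gamma_pos_of_pos (sub_pos.2 ((div_lt_one (by linarith)).2 hα))
  have hpow : ∀ x : Plane, ENNReal.ofReal s * receivedPower α ℓ x (θ, b) g =
      ENNReal.ofReal (s * (Real.cos θ ^ α * channelFactor ℓ b) * g * ‖x‖ ^ (-α)) := fun x => by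
    rw [receivedPower, norm_position x hcos, ← ENNReal.ofReal_mul hs,
      Real.div_rpow (norm_nonneg _) hcos.le, Real.rpow_neg hcos.le, div_inv_eq_mul]
    ring_nf
  simp_rw [hpow]
  rw [lintegral_one_sub_expNeg_mul_norm_rpow_neg volume (by simpa using hα) (by positivity),
    finrank_euclideanSpace_fin, EuclideanSpace.volume_ball_fin_two, ENNReal.ofReal_one, one_pow,
    one_mul, Nat.cast_ofNat, Real.mul_rpow (by positivity) hg, Real.mul_rpow hs (by positivity),
    Real.mul_rpow (by positivity) hL, ← Real.rpow_mul hcos.le,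
    mul_div_cancel₀ _ (by linarith : α ≠ 0), Real.rpow_two, ← ENNReal.ofReal_mul (by positivity),
    ← ENNReal.ofReal_mul (by positivity), ← ENNReal.ofReal_mul (by positivity)]
  ring_nf

end Geometry

section MarkLaw

variable {ν : Measure ℝ} {c₁ c₂ ℓ : ℝ}

@[fun_prop] lemma measurable_losProb (c₁ c₂ : ℝ) : Measurable (losProb c₁ c₂) := by
  unfold losProb
  fun_prop

lemma losProb_pos (hc₂ : 0 ≤ c₂) (c₁ θ : ℝ) : 0 < losProb c₁ c₂ θ := by
  unfold losProb
  positivity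

lemma losProb_le_one (hc₂ : 0 ≤ c₂) (c₁ θ : ℝ) : losProb c₁ c₂ θ ≤ 1 :=
  (div_le_one (by positivity)).2 (le_add_of_nonneg_right (by positivity))

/-- The joint law of elevation angle and line-of-sight indicator. -/
noncomputable def markLaw (ν : Measure ℝ) (c₁ c₂ : ℝ) : Measure (ℝ × Bool) :=
  (ν.withDensity fun θ => ENNReal.ofReal (losProb c₁ c₂ θ)).map (fun θ => (θ, true)) +
  (ν.withDensity fun θ => ENNReal.ofReal (1 - losProb c₁ c₂ θ)).map (fun θ => (θ, false))

lemma lintegral_markLaw (ν : Measure ℝ) (c₁ c₂ : ℝ) {f : ℝ × Bool → ℝ≥0∞} (hf : Measurable f) :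
    ∫⁻ m, f m ∂markLaw ν c₁ c₂ = ∫⁻ θ, (ENNReal.ofReal (losProb c₁ c₂ θ) * f (θ, true) +
      ENNReal.ofReal (1 - losProb c₁ c₂ θ) * f (θ, false)) ∂ν := by
  rw [markLaw, lintegral_add_measure, lintegral_map hf (by fun_prop),
    lintegral_map hf (by fun_prop), lintegral_withDensity_eq_lintegral_mul _ (by fun_prop)
    (by fun_prop), lintegral_withDensity_eq_lintegral_mul _ (by fun_prop) (by fun_prop),
    ← lintegral_add_left (by fun_prop)]
  rfl

lemma quasiMeasurePreserving_fst_markLaw (ν : Measure ℝ) (c₁ c₂ : ℝ) :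
    Measure.QuasiMeasurePreserving Prod.fst (markLaw ν c₁ c₂) ν := by
  refine ⟨measurable_fst, ?_⟩
  rw [markLaw, Measure.map_add _ _ measurable_fst, Measure.map_map measurable_fst (by fun_prop),
    Measure.map_map measurable_fst (by fun_prop)]
  simp only [Function.comp_def, Measure.map_id']
  exact (withDensity_absolutelyContinuous _ _).add_left (withDensity_absolutelyContinuous _ _)

lemma integrable_omega [IsFiniteMeasure ν] (hc₂ : 0 ≤ c₂) (hℓ : 0 ≤ ℓ) (δ : ℝ) :
    Integrable (fun θ => Real.cos θ ^ 2 * (losProb c₁ c₂ θ * (1 - ℓ ^ δ) + ℓ ^ δ)) ν := by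
  refine Integrable.of_bound (by fun_prop) (1 + ℓ ^ δ) (ae_of_all _ fun θ => ?_)
  have hρ₀ := losProb_pos hc₂ c₁ θ
  have hρ₁ := losProb_le_one hc₂ c₁ θ
  have hℓδ : 0 ≤ ℓ ^ δ := Real.rpow_nonneg hℓ _
  have hmix : |losProb c₁ c₂ θ * (1 - ℓ ^ δ) + ℓ ^ δ| ≤ 1 + ℓ ^ δ :=
    abs_le.2 ⟨by nlinarith, by nlinarith⟩
  rw [Real.norm_eq_abs, abs_mul, abs_of_nonneg (sq_nonneg _)]
  exact (mul_le_of_le_one_left (abs_nonneg _) (Real.cos_sq_le_one θ)).trans hmix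

lemma omega_integrand_pos (hc₂ : 0 ≤ c₂) (hℓ : 0 ≤ ℓ) (δ : ℝ) {θ : ℝ}
    (hθ : θ ∈ Set.Ico 0 (Real.pi / 2)) :
    0 < Real.cos θ ^ 2 * (losProb c₁ c₂ θ * (1 - ℓ ^ δ) + ℓ ^ δ) := by
  have hcos := cos_pos_of_mem_Ico hθ
  have hρ₀ := losProb_pos hc₂ c₁ θ
  have hρ₁ := losProb_le_one hc₂ c₁ θ
  have hℓδ : 0 ≤ ℓ ^ δ := Real.rpow_nonneg hℓ _
  exact mul_pos (by positivity) (by nlinarith [mul_nonneg hℓδ (sub_nonneg.2 hρ₁)])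

lemma omega_pos [IsProbabilityMeasure ν] (hc₂ : 0 ≤ c₂) (hℓ : 0 ≤ ℓ) (α : ℝ)
    (hν : ∀ᵐ θ ∂ν, θ ∈ Set.Ico 0 (Real.pi / 2)) : 0 < omega ν c₁ c₂ α ℓ := by
  have hpos := hν.mono fun θ hθ => omega_integrand_pos (c₁ := c₁) hc₂ hℓ (2 / α) hθ
  refine (integral_nonneg_of_ae (hpos.mono fun θ h => h.le)).lt_of_ne' fun hzero => ?_
  rw [integral_eq_zero_iff_of_nonneg_ae (hpos.mono fun θ h => h.le)
    (integrable_omega hc₂ hℓ _)] at hzero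
  obtain ⟨θ, hθ, hθ'⟩ := (hpos.and hzero).exists
  exact hθ.ne' hθ'

lemma lintegral_cos_sq_mul_channelFactor [IsFiniteMeasure ν] (hc₂ : 0 ≤ c₂) (hℓ : 0 ≤ ℓ) (α : ℝ)
    (hν : ∀ᵐ θ ∂ν, θ ∈ Set.Ico 0 (Real.pi / 2)) :
    ∫⁻ m, ENNReal.ofReal (Real.cos m.1 ^ 2 * channelFactor ℓ m.2 ^ (2 / α)) ∂markLaw ν c₁ c₂ =
      ENNReal.ofReal (omega ν c₁ c₂ α ℓ) := by
  rw [lintegral_markLaw ν c₁ c₂ (by fun_prop), omega,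
    ofReal_integral_eq_lintegral_ofReal (integrable_omega hc₂ hℓ _)
      (hν.mono fun θ hθ => (omega_integrand_pos hc₂ hℓ _ hθ).le)]
  refine lintegral_congr fun θ => ?_
  have hρ₀ := losProb_pos hc₂ c₁ θ
  have hρ₁ : 0 ≤ 1 - losProb c₁ c₂ θ := sub_nonneg.2 (losProb_le_one hc₂ c₁ θ)
  simp only [channelFactor, if_true, Bool.false_eq_true, if_false, Real.one_rpow]
  rw [← ENNReal.ofReal_mul hρ₀.le, ← ENNReal.ofReal_mul hρ₁,
    ← ENNReal.ofReal_add (by positivity) (by positivity)]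
  ring_nf

end MarkLaw

section Network

variable {Ω : Type*} [MeasurableSpace Ω] {μ : Measure Ω} {X : ℕ → Ω → Plane}
  {Θ : ℕ → Ω → ℝ} {LoS : ℕ → Ω → Bool} {G : ℕ → Ω → ℝ} {ν : Measure ℝ} {lam c₁ c₂ : ℝ} {N : ℕ}

lemma IsAPILNetwork.isProbabilityMeasure (hnet : IsAPILNetwork μ X Θ LoS G ν lam c₁ c₂ N) :
    IsProbabilityMeasure μ :=
  hnet.gain_indep.isProbabilityMeasure

lemma IsAPILNetwork.isProbabilityMeasure_angle
    (hnet : IsAPILNetwork μ X Θ LoS G ν lam c₁ c₂ N) : IsProbabilityMeasure ν :=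
  (hnet.angle_law 0).isProbabilityMeasure_iff.1 hnet.isProbabilityMeasure

lemma IsAPILNetwork.measurable_mark (hnet : IsAPILNetwork μ X Θ LoS G ν lam c₁ c₂ N) (i : ℕ) :
    Measurable fun w => (Θ i w, LoS i w) :=
  (hnet.angle_measurable i).prodMk (hnet.los_measurable i)

lemma IsAPILNetwork.measurable_shotSignal (hnet : IsAPILNetwork μ X Θ LoS G ν lam c₁ c₂ N)
    (α ℓ : ℝ) : Measurable (shotSignal X Θ LoS G α ℓ) :=
  Measurable.tsum fun i => (measurable_receivedPower α ℓ).comp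
    (((hnet.projections.measurable i).prodMk (hnet.measurable_mark i)).prodMk
      (hnet.gain_measurable i))

lemma IsAPILNetwork.measurableSet_angle_los (hnet : IsAPILNetwork μ X Θ LoS G ν lam c₁ c₂ N)
    (i : ℕ) {B : Set ℝ} (hB : MeasurableSet B) (b : Bool) :
    MeasurableSet {w | Θ i w ∈ B ∧ LoS i w = b} :=
  (hnet.angle_measurable i hB).inter (hnet.los_measurable i (measurableSet_singleton b))

lemma IsAPILNetwork.nlos_law (hnet : IsAPILNetwork μ X Θ LoS G ν lam c₁ c₂ N) (hc₂ : 0 ≤ c₂)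
    (i : ℕ) {B : Set ℝ} (hB : MeasurableSet B) :
    μ {w | Θ i w ∈ B ∧ LoS i w = false} =
      ∫⁻ θ in B, ENNReal.ofReal (1 - losProb c₁ c₂ θ) ∂ν := by
  have := hnet.isProbabilityMeasure
  have hcompl : {w | Θ i w ∈ B ∧ LoS i w = false} =
      (Θ i ⁻¹' B) \ {w | Θ i w ∈ B ∧ LoS i w = true} := by
    ext w
    cases hlos : LoS i w <;> simp [hlos]
  have hfin : ∫⁻ θ in B, ENNReal.ofReal (losProb c₁ c₂ θ) ∂ν ≠ ∞ :=
    hnet.los_law i B hB ▸ measure_ne_top _ _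
  rw [hcompl, measure_sdiff (s₁ := Θ i ⁻¹' B) (fun w hw => hw.1)
    (hnet.measurableSet_angle_los i hB true).nullMeasurableSet (measure_ne_top _ _),
    hnet.los_law i B hB, ← Measure.map_apply (hnet.angle_measurable i) hB,
    (hnet.angle_law i).map_eq]
  simp_rw [ENNReal.ofReal_sub 1 (losProb_pos hc₂ c₁ _).le, ENNReal.ofReal_one]
  rw [lintegral_sub (by fun_prop) hfin (ae_of_all _ fun θ =>
    ENNReal.ofReal_le_one.2 (losProb_le_one hc₂ _ _)), setLIntegral_const, one_mul]

lemma IsAPILNetwork.hasLaw_mark (hnet : IsAPILNetwork μ X Θ LoS G ν lam c₁ c₂ N)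
    (hc₂ : 0 ≤ c₂) (i : ℕ) : HasLaw (fun w => (Θ i w, LoS i w)) (markLaw ν c₁ c₂) μ := by
  refine ⟨(hnet.measurable_mark i).aemeasurable, ?_⟩
  ext S hS
  have hT : MeasurableSet {θ : ℝ | (θ, true) ∈ S} := measurable_prodMk_right hS
  have hF : MeasurableSet {θ : ℝ | (θ, false) ∈ S} := measurable_prodMk_right hS
  have hsplit : (fun w => (Θ i w, LoS i w)) ⁻¹' S =
      {w | Θ i w ∈ {θ : ℝ | (θ, true) ∈ S} ∧ LoS i w = true} ∪
      {w | Θ i w ∈ {θ : ℝ | (θ, false) ∈ S} ∧ LoS i w = false} := by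
    ext w
    cases hlos : LoS i w <;> simp [hlos]
  have hdisj : Disjoint {w | Θ i w ∈ {θ : ℝ | (θ, true) ∈ S} ∧ LoS i w = true}
      {w | Θ i w ∈ {θ : ℝ | (θ, false) ∈ S} ∧ LoS i w = false} :=
    Set.disjoint_left.2 fun w htrue hfalse => by simp [htrue.2] at hfalse
  rw [Measure.map_apply (hnet.measurable_mark i) hS, hsplit,
    measure_union' hdisj (hnet.measurableSet_angle_los i hT true), hnet.los_law i _ hT,
    hnet.nlos_law hc₂ i hF, markLaw, Measure.add_apply, Measure.map_apply (by fun_prop) hS,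
    Measure.map_apply (by fun_prop) hS, withDensity_apply _ (measurable_prodMk_right hS),
    withDensity_apply _ (measurable_prodMk_right hS)]
  rfl

lemma IsAPILNetwork.isProbabilityMeasure_markLaw
    (hnet : IsAPILNetwork μ X Θ LoS G ν lam c₁ c₂ N) (hc₂ : 0 ≤ c₂) :
    IsProbabilityMeasure (markLaw ν c₁ c₂) :=
  (hnet.hasLaw_mark hc₂ 0).isProbabilityMeasure_iff.1 hnet.isProbabilityMeasure

lemma IsAPILNetwork.isProbabilityMeasure_gain
    (hnet : IsAPILNetwork μ X Θ LoS G ν lam c₁ c₂ N) : IsProbabilityMeasure (gammaMeasure N 1) :=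
  (hnet.gain_law 0).isProbabilityMeasure_iff.1 hnet.isProbabilityMeasure

theorem IsAPILNetwork.lintegral_expNeg_mul_shotSignal
    (hnet : IsAPILNetwork μ X Θ LoS G ν lam c₁ c₂ N) (hc₂ : 0 ≤ c₂) (α ℓ : ℝ) (s : ℝ≥0∞) :
    ∫⁻ w, expNeg (s * shotSignal X Θ LoS G α ℓ w) ∂μ =
      expNeg (ENNReal.ofReal lam * ∫⁻ m, ∫⁻ g, (∫⁻ x : Plane,
        (1 - expNeg (s * receivedPower α ℓ x m g))) ∂gammaMeasure N 1 ∂markLaw ν c₁ c₂) := by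
  have := hnet.isProbabilityMeasure_gain
  have := hnet.isProbabilityMeasure_markLaw hc₂
  have hσ : SigmaFinite (ENNReal.ofReal lam • (volume : Measure Plane)) :=
    inferInstanceAs (SigmaFinite (lam.toNNReal • (volume : Measure Plane)))
  have hXm := hnet.projections.measurable
  have hpower : Measurable fun p : (Plane × (ℝ × Bool)) × ℝ =>
    s * receivedPower α ℓ p.1.1 p.1.2 p.2 := (measurable_receivedPower α ℓ).const_mul s
  have hloss : Measurable fun p : (Plane × (ℝ × Bool)) × ℝ =>
    1 - expNeg (s * receivedPower α ℓ p.1.1 p.1.2 p.2) := by fun_prop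
  have hgain : ∀ q : Plane × (ℝ × Bool), Measurable fun g => s * receivedPower α ℓ q.1 q.2 g :=
    fun q => hpower.comp measurable_prodMk_left
  simp only [shotSignal, ← ENNReal.tsum_mul_left]
  calc ∫⁻ w, expNeg (∑' i, s * receivedPower α ℓ (X i w) (Θ i w, LoS i w) (G i w)) ∂μ
      = ∫⁻ w, expNeg (∑' i, laplaceExponent (gammaMeasure N 1) fun g =>
          s * receivedPower α ℓ (X i w) (Θ i w, LoS i w) g) ∂μ :=
        lintegral_expNeg_tsum_iid_marks (W := fun i w => (X i w, (Θ i w, LoS i w)))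
          hnet.gain_measurable (fun i => (hXm i).prodMk (hnet.measurable_mark i))
          hnet.gain_indep hnet.gain_law hnet.gain_indep_rest hpower
    _ = expNeg (∫⁻ x, ∫⁻ m, ∫⁻ g, (1 - expNeg (s * receivedPower α ℓ x m g))
          ∂gammaMeasure N 1 ∂markLaw ν c₁ c₂ ∂(ENNReal.ofReal lam • volume)) := by
        rw [hnet.projections.laplaceFunctional_marked hnet.measurable_mark hnet.mark_indep
          (hnet.hasLaw_mark hc₂) hnet.mark_indep_projections (measurable_laplaceExponent hpower)]
        simp_rw [expNeg_laplaceExponent, one_sub_lintegral_expNeg (hgain (_, _))]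
    _ = _ := by
        rw [lintegral_smul_measure, smul_eq_mul,
          lintegral_lintegral_swap hloss.lintegral_prod_right'.aemeasurable]
        congr! 5 with m
        exact lintegral_lintegral_swap (hloss.comp (g := fun p : (Plane × (ℝ × Bool)) × ℝ =>
          1 - expNeg (s * receivedPower α ℓ p.1.1 p.1.2 p.2))
          (f := fun p : Plane × ℝ => ((p.1, m), p.2)) (by fun_prop)).aemeasurable

/-- The scale `K` in the Laplace transform `exp (-K s^(2/α))` of the received signal. -/
noncomputable def signalScale (ν : Measure ℝ) (lam c₁ c₂ α ℓ : ℝ) (N : ℕ) : ℝ :=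
  Real.pi * lam * omega ν c₁ c₂ α ℓ / (N - 1).factorial *
    Real.Gamma (N + 2 / α) * Real.Gamma (1 - 2 / α)

lemma signalScale_pos [IsProbabilityMeasure ν] (hlam : 0 < lam) (hc₂ : 0 ≤ c₂) {ℓ α : ℝ}
    (hα : 2 < α) (hℓ : 0 ≤ ℓ) (hν : ∀ᵐ θ ∂ν, θ ∈ Set.Ico 0 (Real.pi / 2)) (N : ℕ) :
    0 < signalScale ν lam c₁ c₂ α ℓ N := by
  have hω := omega_pos (c₁ := c₁) hc₂ hℓ α hν
  have hΓ : 0 < Real.Gamma (1 - 2 / α) :=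
    Real.Gamma_pos_of_pos (sub_pos.2 ((div_lt_one (by linarith)).2 hα))
  unfold signalScale
  positivity

lemma lintegral_one_sub_expNeg_receivedPower_marks [IsProbabilityMeasure ν] (hc₂ : 0 ≤ c₂)
    (hN : 1 ≤ N) {α ℓ s : ℝ} (hα : 2 < α) (hℓ : 0 ≤ ℓ) (hs : 0 ≤ s)
    (hν : ∀ᵐ θ ∂ν, θ ∈ Set.Ico 0 (Real.pi / 2)) :
    ∫⁻ m, ∫⁻ g, (∫⁻ x : Plane, (1 - expNeg (ENNReal.ofReal s * receivedPower α ℓ x m g)))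
        ∂gammaMeasure N 1 ∂markLaw ν c₁ c₂ =
      ENNReal.ofReal (Real.pi * s ^ (2 / α) * Real.Gamma (1 - 2 / α)) *
        (ENNReal.ofReal (omega ν c₁ c₂ α ℓ) *
          ENNReal.ofReal (Real.Gamma (N + 2 / α) / (N - 1).factorial)) := by
  have hN₀ : (0 : ℝ) < N := by exact_mod_cast hN
  have hΓN : Real.Gamma N = (N - 1).factorial := by
    rw [← Real.Gamma_nat_eq_factorial, Nat.cast_sub hN, Nat.cast_one, sub_add_cancel]
  have hmean : ∫⁻ g, ENNReal.ofReal (g ^ (2 / α)) ∂gammaMeasure N 1 =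
      ENNReal.ofReal (Real.Gamma (N + 2 / α) / (N - 1).factorial) := by
    rw [lintegral_rpow_gammaMeasure hN₀ one_pos (by positivity), Real.one_rpow, mul_one, hΓN]
  rw [← lintegral_cos_sq_mul_channelFactor hc₂ hℓ α hν, ← hmean,
    ← lintegral_mul_const _ (by fun_prop), ← lintegral_const_mul _ (by fun_prop)]
  refine lintegral_congr_ae (((quasiMeasurePreserving_fst_markLaw ν c₁ c₂).ae hν).mono
    fun m hm => ?_)
  beta_reduce
  rw [← lintegral_const_mul _ (by fun_prop), ← lintegral_const_mul _ (by fun_prop)]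
  exact lintegral_congr_ae ((ae_pos_gammaMeasure _ _).mono fun g hg =>
    lintegral_one_sub_expNeg_receivedPower hα hℓ hs (le_of_lt hg) hm m.2)

theorem IsAPILNetwork.lintegral_expNeg_shotSignal
    (hnet : IsAPILNetwork μ X Θ LoS G ν lam c₁ c₂ N) (hlam : 0 < lam) (hc₂ : 0 ≤ c₂)
    (hN : 1 ≤ N) {α ℓ s : ℝ} (hα : 2 < α) (hℓ : 0 ≤ ℓ) (hs : 0 ≤ s) :
    ∫⁻ w, expNeg (ENNReal.ofReal s * shotSignal X Θ LoS G α ℓ w) ∂μ =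
      ENNReal.ofReal (Real.exp (-(signalScale ν lam c₁ c₂ α ℓ N * s ^ (2 / α)))) := by
  have := hnet.isProbabilityMeasure_angle
  have hK := signalScale_pos (c₁ := c₁) hlam hc₂ hα hℓ hnet.angle_mem N
  have hω := omega_pos (c₁ := c₁) hc₂ hℓ α hnet.angle_mem
  have hΓ : 0 < Real.Gamma (1 - 2 / α) :=
    Real.Gamma_pos_of_pos (sub_pos.2 ((div_lt_one (by linarith)).2 hα))
  rw [hnet.lintegral_expNeg_mul_shotSignal hc₂, ← expNeg_ofReal (by positivity),
    lintegral_one_sub_expNeg_receivedPower_marks hc₂ hN hα hℓ hs hnet.angle_mem,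
    ← ENNReal.ofReal_mul hω.le, ← ENNReal.ofReal_mul (by positivity),
    ← ENNReal.ofReal_mul hlam.le, signalScale]
  ring_nf

end Network

section LaplaceInversion

open scoped FourierTransform

/-- The two-sided Laplace transform `∫ exp (-s t) f t dt` over the whole line, with the junk value
`0` where the integral does not converge absolutely. -/
noncomputable def bilateralLaplace (f : ℝ → ℂ) (s : ℂ) : ℂ :=
  ∫ t : ℝ, Complex.exp (-s * t) * f t

/-- The Bromwich integral `(2πi)⁻¹ ∫ exp (s t) F s ds` over the line `Re s = γ`, as an absolutely
convergent integral in the imaginary part of `s`. -/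
noncomputable def bromwichIntegral (F : ℂ → ℂ) (γ t : ℝ) : ℂ :=
  1 / (2 * (Real.pi : ℂ)) *
    ∫ y : ℝ, Complex.exp (((γ : ℂ) + y * Complex.I) * t) * F (γ + y * Complex.I)

lemma fourier_cexp_mul_eq_bilateralLaplace (f : ℝ → ℂ) (γ ξ : ℝ) :
    𝓕 (fun t : ℝ => Complex.exp (-(γ : ℂ) * t) * f t) ξ =
      bilateralLaplace f (γ + (2 * Real.pi * ξ : ℝ) * Complex.I) := by
  rw [Real.fourier_real_eq_integral_exp_smul, bilateralLaplace]
  refine integral_congr_ae (ae_of_all _ fun t => ?_)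
  simp only [smul_eq_mul, ← mul_assoc, ← Complex.exp_add]
  push_cast
  ring_nf

lemma bromwichIntegral_eq_cexp_mul (F : ℂ → ℂ) (γ t : ℝ) :
    bromwichIntegral F γ t = Complex.exp (γ * t) * (1 / (2 * (Real.pi : ℂ)) *
      ∫ y : ℝ, Complex.exp ((y * t : ℝ) * Complex.I) * F (γ + y * Complex.I)) := by
  rw [bromwichIntegral, mul_left_comm, ← integral_const_mul (Complex.exp (γ * t))]
  congr! 3
  rw [← mul_assoc, ← Complex.exp_add]
  push_cast
  ring_nf

lemma bromwichIntegral_eq_cexp_mul_fourierInv (F : ℂ → ℂ) (γ t : ℝ) :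
    bromwichIntegral F γ t = Complex.exp (γ * t) *
      𝓕⁻ (fun ξ : ℝ => F (γ + (2 * Real.pi * ξ : ℝ) * Complex.I)) t := by
  have hscale := Measure.integral_comp_mul_left
    (fun y : ℝ => Complex.exp ((y * t : ℝ) * Complex.I) * F (γ + y * Complex.I)) (2 * Real.pi)
  rw [abs_of_pos (by positivity), Complex.real_smul, Complex.ofReal_inv, Complex.ofReal_mul,
    Complex.ofReal_ofNat, ← one_div] at hscale
  rw [bromwichIntegral_eq_cexp_mul, ← hscale, Real.fourierInv_eq']
  simp only [smul_eq_mul, RCLike.inner_apply, conj_trivial]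
  congr! 7
  ring

theorem bromwichIntegral_bilateralLaplace {f : ℝ → ℂ} {γ t : ℝ}
    (hf : Integrable fun t : ℝ => Complex.exp (-(γ : ℂ) * t) * f t)
    (hF : Integrable fun y : ℝ => bilateralLaplace f (γ + y * Complex.I))
    (hcont : ContinuousAt f t) : bromwichIntegral (bilateralLaplace f) γ t = f t := by
  have hFourier := funext (fourier_cexp_mul_eq_bilateralLaplace f γ)
  have hFint : Integrable (𝓕 fun t : ℝ => Complex.exp (-(γ : ℂ) * t) * f t) :=
    hFourier ▸ hF.comp_mul_left' (by positivity)
  rw [bromwichIntegral_eq_cexp_mul_fourierInv, ← hFourier,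
    hf.fourierInv_fourier_eq hFint (by fun_prop), ← mul_assoc, ← Complex.exp_add, neg_mul,
    add_neg_cancel, Complex.exp_zero, one_mul]

lemma norm_cexp_vertical_mul (γ y t : ℝ) :
    ‖Complex.exp (((γ : ℂ) + y * Complex.I) * t)‖ = Real.exp (γ * t) := by
  simp [Complex.norm_exp]

lemma continuous_bromwichIntegral {F : ℂ → ℂ} {γ : ℝ}
    (hF : Integrable fun y : ℝ => F (γ + y * Complex.I)) : Continuous (bromwichIntegral F γ) := by
  have hint : Continuous fun t : ℝ => ∫ y : ℝ, Complex.exp ((y * t : ℝ) * Complex.I) *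
      F (γ + y * Complex.I) :=
    continuous_of_dominated
      (fun t => (by fun_prop : Continuous fun y : ℝ => Complex.exp ((y * t : ℝ) * Complex.I))
        |>.aestronglyMeasurable.mul hF.aestronglyMeasurable)
      (fun t => ae_of_all _ fun y => by
        rw [norm_mul, Complex.norm_exp_ofReal_mul_I, one_mul])
      hF.norm (ae_of_all _ fun y => by fun_prop)
  rw [funext (bromwichIntegral_eq_cexp_mul F γ)]
  fun_prop

lemma tendsto_bromwichIntegral {F : ℂ → ℂ} {γ : ℝ}
    (hF : Integrable fun y : ℝ => F (γ + y * Complex.I)) (t : ℝ) :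
    Tendsto (fun T : ℝ => (1 / (2 * (Real.pi : ℂ))) *
      ∫ y in (-T)..T, Complex.exp (((γ : ℂ) + y * Complex.I) * t) * F (γ + y * Complex.I))
      atTop (𝓝 (bromwichIntegral F γ t)) := by
  refine (intervalIntegral_tendsto_integral ?_ tendsto_neg_atTop_atBot tendsto_id).const_mul _
  exact hF.bdd_mul (by fun_prop) (ae_of_all _ fun y => (norm_cexp_vertical_mul γ y t).le)

lemma eq_of_monotone_of_continuous_of_countable {H c : ℝ → ℝ} (hH : Monotone H)
    (hc : Continuous c) {D : Set ℝ} (hD : D.Countable) (h : ∀ t ∉ D, H t = c t) : H = c := by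
  have hclosure : ∀ U : Set ℝ, IsOpen U → closure U ⊆ closure (U ∩ Dᶜ) := fun U hU =>
    closure_minimal ((hD.dense_compl ℝ).open_subset_closure_inter hU) isClosed_closure
  funext t
  refine le_antisymm ?_ ?_
  · refine closure_minimal (s := Set.Ioi t ∩ Dᶜ) (t := {b | H t ≤ c b}) ?_
      (isClosed_le continuous_const hc) (hclosure _ isOpen_Ioi (by simp))
    exact fun b hb => (hH (le_of_lt hb.1)).trans_eq (h b hb.2)
  · refine closure_minimal (s := Set.Iio t ∩ Dᶜ) (t := {b | c b ≤ H t}) ?_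
      (isClosed_le hc continuous_const) (hclosure _ isOpen_Iio (by simp))
    exact fun b hb => (h b hb.2).symm.trans_le (hH (le_of_lt hb.1))

theorem bromwichIntegral_bilateralLaplace_of_monotone {H : ℝ → ℝ} (hH : Monotone H) {γ : ℝ}
    (hint : Integrable fun t : ℝ => Complex.exp (-(γ : ℂ) * t) * H t)
    (hF : Integrable fun y : ℝ => bilateralLaplace (fun t => H t) (γ + y * Complex.I)) (t : ℝ) :
    bromwichIntegral (bilateralLaplace fun t => H t) γ t = H t := by
  have hinv : ∀ x, ContinuousAt H x →
      bromwichIntegral (bilateralLaplace fun t => H t) γ x = H x := fun x hx =>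
    bromwichIntegral_bilateralLaplace hint hF (Complex.continuous_ofReal.continuousAt.comp hx)
  have hcont : Continuous fun x => (bromwichIntegral (bilateralLaplace fun t => H t) γ x).re :=
    Complex.continuous_re.comp (continuous_bromwichIntegral hF)
  have hHeq := eq_of_monotone_of_continuous_of_countable hH hcont hH.countable_not_continuousAt
    fun x hx => by rw [hinv x (not_not.1 hx), Complex.ofReal_re]
  exact hinv t (hHeq.symm ▸ hcont.continuousAt)

end LaplaceInversion

section DistributionFunction

variable {Ω : Type*} [MeasurableSpace Ω] {μ : Measure Ω} {Y : Ω → ℝ}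

lemma integral_indicator_lt_cexp {s : ℂ} (hs : 0 < s.re) (y : ℝ) :
    ∫ t : ℝ, (Set.Ioi y).indicator (fun t : ℝ => Complex.exp (-s * t)) t =
      1 / s * Complex.exp (-s * y) := by
  rw [integral_indicator measurableSet_Ioi, integral_exp_mul_complex_Ioi (by simpa using hs),
    neg_div_neg_eq]
  ring

lemma integral_indicator_lt_cexp_measureReal (hY : Measurable Y) (s : ℂ) (t : ℝ) :
    ∫ w, (Set.Ioi (Y w)).indicator (fun t : ℝ => Complex.exp (-s * t)) t ∂μ =
      Complex.exp (-s * t) * (μ.real {w | Y w < t} : ℝ) := by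
  have hflip : (fun w => (Set.Ioi (Y w)).indicator (fun t : ℝ => Complex.exp (-s * t)) t) =
      {w | Y w < t}.indicator fun _ => Complex.exp (-s * t) := by
    funext w
    simp [Set.indicator]
  rw [hflip, integral_indicator (measurableSet_lt hY measurable_const), setIntegral_const,
    Complex.real_smul, mul_comm]

variable [IsFiniteMeasure μ]

lemma monotone_measureReal_lt (Y : Ω → ℝ) : Monotone fun t => μ.real {w | Y w < t} :=
  fun _ _ hab => measureReal_mono fun _ hw => lt_of_lt_of_le hw hab

lemma integrable_indicator_lt_cexp (hY : Measurable Y) {s : ℂ} (hs : 0 < s.re)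
    (hexp : -s.re ∈ integrableExpSet Y μ) :
    Integrable (fun p : ℝ × Ω => (Set.Ioi (Y p.2)).indicator
      (fun t : ℝ => Complex.exp (-s * t)) p.1) (volume.prod μ) := by
  have hre : (-s).re < 0 := by simpa using hs
  have hmeas : Measurable fun p : ℝ × Ω => (Set.Ioi (Y p.2)).indicator
      (fun t : ℝ => Complex.exp (-s * t)) p.1 :=
    (by fun_prop : Measurable fun p : ℝ × Ω => Complex.exp (-s * p.1)).indicator
      (measurableSet_lt (by fun_prop : Measurable fun p : ℝ × Ω => Y p.2) measurable_fst)
  have hnorm : ∀ w, ∫ t : ℝ, ‖(Set.Ioi (Y w)).indicator (fun t : ℝ => Complex.exp (-s * t)) t‖ =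
      Real.exp (-s.re * Y w) / s.re := fun w => by
    simp_rw [norm_indicator_eq_indicator_norm, Complex.norm_exp, Complex.re_mul_ofReal]
    rw [integral_indicator measurableSet_Ioi, integral_exp_mul_Ioi hre, Complex.neg_re,
      neg_div_neg_eq]
  refine (integrable_prod_iff' hmeas.aestronglyMeasurable).2 ⟨ae_of_all _ fun w => ?_, ?_⟩
  · exact (integrableOn_exp_mul_complex_Ioi hre (Y w)).integrable_indicator measurableSet_Ioi
  · simp_rw [hnorm]
    exact hexp.div_const _

lemma integrable_cexp_mul_measureReal_lt (hY : Measurable Y) {s : ℂ} (hs : 0 < s.re)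
    (hexp : -s.re ∈ integrableExpSet Y μ) :
    Integrable fun t : ℝ => Complex.exp (-s * t) * (μ.real {w | Y w < t} : ℝ) := by
  simpa only [integral_indicator_lt_cexp_measureReal hY s] using
    (integrable_indicator_lt_cexp hY hs hexp).integral_prod_left

theorem bilateralLaplace_measureReal_lt (hY : Measurable Y) {s : ℂ} (hs : 0 < s.re)
    (hexp : -s.re ∈ integrableExpSet Y μ) :
    bilateralLaplace (fun t => (μ.real {w | Y w < t} : ℝ)) s = 1 / s * complexMGF Y μ (-s) := by
  simp_rw [bilateralLaplace, ← integral_indicator_lt_cexp_measureReal hY s]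
  rw [integral_integral_swap (integrable_indicator_lt_cexp hY hs hexp)]
  simp_rw [integral_indicator_lt_cexp hs, integral_const_mul, complexMGF]

theorem hasInverseLaplaceAt_complexMGF (hY : Measurable Y) {a : ℝ} (ha : 0 ≤ a)
    (hexp : ∀ γ, a < γ → -γ ∈ integrableExpSet Y μ)
    (hint : ∀ γ : ℝ, a < γ → Integrable fun y : ℝ =>
      1 / ((γ : ℂ) + y * Complex.I) * complexMGF Y μ (-((γ : ℂ) + y * Complex.I))) (t : ℝ) :
    HasInverseLaplaceAt (fun s => 1 / s * complexMGF Y μ (-s)) a t (μ.real {w | Y w < t} : ℝ) := by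
  have hre : ∀ γ y : ℝ, ((γ : ℂ) + y * Complex.I).re = γ := fun γ y => by simp
  have hsub : Set.Iio (-a) ⊆ interior (integrableExpSet Y μ) :=
    interior_maximal (fun r hr => neg_neg r ▸ hexp (-r) (lt_neg_of_lt_neg hr)) isOpen_Iio
  refine ⟨fun s hs => ?_, fun γ hγ => ?_⟩
  · have hs₀ : s ≠ 0 := by
      rintro rfl
      exact ha.not_gt hs
    have hmgf : DifferentiableAt ℂ (complexMGF Y μ) (-s) :=
      (hasDerivAt_complexMGF (hsub (by simpa using hs))).differentiableAt
    exact (((differentiableAt_const 1).div differentiableAt_id hs₀).mul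
      (hmgf.comp s differentiableAt_id.neg)).differentiableWithinAt
  · have hLaplace : ∀ y : ℝ, bilateralLaplace (fun t => (μ.real {w | Y w < t} : ℝ))
        (γ + y * Complex.I) =
        1 / ((γ : ℂ) + y * Complex.I) * complexMGF Y μ (-((γ : ℂ) + y * Complex.I)) := fun y =>
      bilateralLaplace_measureReal_lt hY (by rw [hre]; exact ha.trans_lt hγ)
        (by rw [hre]; exact hexp γ hγ)
    simp only [← hLaplace]
    have hF := hint γ hγ
    simp only [← hLaplace] at hF
    rw [← bromwichIntegral_bilateralLaplace_of_monotone (monotone_measureReal_lt Y)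
      (integrable_cexp_mul_measureReal_lt hY (by simpa using ha.trans_lt hγ)
        (by simpa using hexp γ hγ)) hF t]
    exact tendsto_bromwichIntegral hF t

end DistributionFunction

section StableTransform

variable {K δ : ℝ} {s : ℂ}

/-- The Laplace transform `s⁻¹ exp (-K s^δ)` of the distribution function of the one-sided stable
law with index `δ` and scale `K`. -/
noncomputable def stableTransform (K δ : ℝ) (s : ℂ) : ℂ :=
  1 / s * Complex.exp (-((K : ℂ) * s ^ (δ : ℂ)))

lemma differentiableAt_cexp_neg_mul_cpow (K δ : ℝ) (hs : 0 < s.re) :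
    DifferentiableAt ℂ (fun s : ℂ => Complex.exp (-((K : ℂ) * s ^ (δ : ℂ)))) s :=
  ((differentiableAt_id.cpow_const (Or.inl hs)).const_mul (K : ℂ)).neg.cexp

lemma differentiableAt_stableTransform (K δ : ℝ) (hs : 0 < s.re) :
    DifferentiableAt ℂ (stableTransform K δ) s := by
  have hs₀ : s ≠ 0 := by rintro rfl; simp at hs
  exact ((differentiableAt_const 1).div differentiableAt_id hs₀).mul
    (differentiableAt_cexp_neg_mul_cpow K δ hs)

lemma norm_rpow_mul_cos_le_re_cpow (hδ : δ ∈ Set.Icc (0 : ℝ) 1) (hs : 0 ≤ s.re) :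
    ‖s‖ ^ δ * Real.cos (Real.pi / 2 * δ) ≤ (s ^ (δ : ℂ)).re := by
  have harg : |s.arg| ≤ Real.pi / 2 := Complex.abs_arg_le_pi_div_two_iff.2 hs
  rw [Complex.cpow_ofReal_re, ← Real.cos_abs (s.arg * δ), abs_mul, abs_of_nonneg hδ.1]
  gcongr
  refine Real.cos_le_cos_of_nonneg_of_le_pi (mul_nonneg (abs_nonneg _) hδ.1) ?_
    (mul_le_mul_of_nonneg_right harg hδ.1)
  nlinarith [Real.pi_pos, hδ.2, hδ.1]

lemma integrable_exp_neg_mul_abs_rpow {k : ℝ} (hδ : 0 < δ) (hk : 0 < k) :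
    Integrable fun y : ℝ => Real.exp (-k * |y| ^ δ) := by
  refine Integrable.of_integral_ne_zero ?_
  rw [integral_comp_abs (f := fun y => Real.exp (-k * y ^ δ)), integral_exp_neg_mul_rpow hδ hk]
  positivity

lemma norm_stableTransform_vertical_le (hK : 0 ≤ K) (hδ : δ ∈ Set.Icc (0 : ℝ) 1) {γ : ℝ}
    (hγ : 0 < γ) (y : ℝ) : ‖stableTransform K δ (γ + y * Complex.I)‖ ≤
      γ⁻¹ * Real.exp (-(K * Real.cos (Real.pi / 2 * δ)) * |y| ^ δ) := by
  set s : ℂ := γ + y * Complex.I with hs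
  have hre : s.re = γ := by simp [hs]
  have hγs : γ ≤ ‖s‖ := by simpa [hre, abs_of_pos hγ] using Complex.abs_re_le_norm s
  have hys : |y| ≤ ‖s‖ := by simpa [hs] using Complex.abs_im_le_norm s
  have hcos : 0 ≤ Real.cos (Real.pi / 2 * δ) := Real.cos_nonneg_of_mem_Icc
    ⟨by nlinarith [Real.pi_pos, hδ.1], by nlinarith [Real.pi_pos, hδ.2]⟩
  have hcpow : |y| ^ δ * Real.cos (Real.pi / 2 * δ) ≤ (s ^ (δ : ℂ)).re :=
    (mul_le_mul_of_nonneg_right (Real.rpow_le_rpow (abs_nonneg _) hys hδ.1) hcos).trans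
      (norm_rpow_mul_cos_le_re_cpow hδ (hre ▸ hγ.le))
  rw [stableTransform, norm_mul, Complex.norm_exp, one_div, norm_inv, Complex.neg_re,
    Complex.re_ofReal_mul]
  refine mul_le_mul (inv_anti₀ hγ hγs) (Real.exp_le_exp.2 ?_) (Real.exp_pos _).le (by positivity)
  nlinarith [mul_le_mul_of_nonneg_left hcpow hK]

lemma integrable_stableTransform_vertical (hK : 0 < K) (hδ : δ ∈ Set.Ioo (0 : ℝ) 1) {γ : ℝ}
    (hγ : 0 < γ) : Integrable fun y : ℝ => stableTransform K δ (γ + y * Complex.I) := by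
  have hcos : 0 < Real.cos (Real.pi / 2 * δ) :=
    Real.cos_pos_of_mem_Ioo ⟨by nlinarith [Real.pi_pos, hδ.1], by nlinarith [Real.pi_pos, hδ.2]⟩
  have hcont : Continuous fun y : ℝ => stableTransform K δ (γ + y * Complex.I) :=
    continuous_iff_continuousAt.2 fun y =>
      (differentiableAt_stableTransform K δ (by simpa using hγ)).continuousAt.comp
        (f := fun y : ℝ => (γ : ℂ) + y * Complex.I) (by fun_prop)
  exact ((integrable_exp_neg_mul_abs_rpow hδ.1 (mul_pos hK hcos)).const_mul γ⁻¹).mono'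
    hcont.aestronglyMeasurable
    (ae_of_all _ (norm_stableTransform_vertical_le hK.le (Set.Ioo_subset_Icc_self hδ) hγ))

end StableTransform

section HasInverseLaplaceAt

variable {F F' : ℂ → ℂ} {a t : ℝ} {v v' : ℂ}

lemma HasInverseLaplaceAt.congr (hF : HasInverseLaplaceAt F a t v)
    (heq : Set.EqOn F F' {s | a < s.re}) : HasInverseLaplaceAt F' a t v := by
  refine ⟨hF.1.congr heq.symm, fun γ hγ => (hF.2 γ hγ).congr fun T => ?_⟩
  have hvert : ∀ y : ℝ, F ((γ : ℂ) + y * Complex.I) = F' ((γ : ℂ) + y * Complex.I) :=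
    fun y => heq (by simpa using hγ)
  simp_rw [hvert]

lemma HasInverseLaplaceAt.unique (hv : HasInverseLaplaceAt F a t v)
    (hv' : HasInverseLaplaceAt F a t v') : v = v' :=
  tendsto_nhds_unique (hv.2 (a + 1) (lt_add_one a)) (hv'.2 (a + 1) (lt_add_one a))

end HasInverseLaplaceAt

section StableLaw

variable {Ω : Type*} [MeasurableSpace Ω] {μ : Measure Ω} {Y : Ω → ℝ} {K δ : ℝ}

/-- `Y` has the Laplace transform `s ↦ exp (-K s^δ)`, `s > 0`, of the one-sided stable law with
index `δ` and scale `K`. No sign condition on `Y` is imposed: the formula entails that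
`exp (-s Y)` is integrable, because its integral is not the junk value `0`. -/
def HasStableLaplaceTransform (Y : Ω → ℝ) (K δ : ℝ) (μ : Measure Ω) : Prop :=
  ∀ s : ℝ, 0 < s → mgf Y μ (-s) = Real.exp (-(K * s ^ δ))

namespace HasStableLaplaceTransform

lemma neg_mem_integrableExpSet (hstable : HasStableLaplaceTransform Y K δ μ) {s : ℝ}
    (hs : 0 < s) : -s ∈ integrableExpSet Y μ := by
  refine Integrable.of_integral_ne_zero ?_
  rw [← mgf, hstable s hs]
  exact (Real.exp_pos _).ne'

lemma analyticOnNhd_complexMGF_neg (hstable : HasStableLaplaceTransform Y K δ μ) :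
    AnalyticOnNhd ℂ (fun s => complexMGF Y μ (-s)) {s | 0 < s.re} := by
  have hsub : Set.Iio (0 : ℝ) ⊆ interior (integrableExpSet Y μ) :=
    interior_maximal (fun s hs => by
      simpa using hstable.neg_mem_integrableExpSet (neg_pos.2 hs)) isOpen_Iio
  intro s hs
  have hs' : (-s).re < 0 := by simpa using hs
  exact (analyticAt_complexMGF (hsub hs')).comp_of_eq (analyticAt_id.neg) rfl

lemma complexMGF_neg_ofReal (hstable : HasStableLaplaceTransform Y K δ μ) {s : ℝ}
    (hs : 0 < s) :
    complexMGF Y μ (-(s : ℂ)) = Complex.exp (-((K : ℂ) * (s : ℂ) ^ (δ : ℂ))) := by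
  rw [← Complex.ofReal_neg, complexMGF_ofReal, hstable s hs, ← Complex.ofReal_cpow hs.le]
  push_cast
  rfl

lemma complexMGF_neg (hstable : HasStableLaplaceTransform Y K δ μ) {s : ℂ} (hs : 0 < s.re) :
    complexMGF Y μ (-s) = Complex.exp (-((K : ℂ) * s ^ (δ : ℂ))) := by
  have hright : AnalyticOnNhd ℂ (fun s : ℂ => Complex.exp (-((K : ℂ) * s ^ (δ : ℂ))))
      {s | 0 < s.re} := DifferentiableOn.analyticOnNhd
    (fun s hs => (differentiableAt_cexp_neg_mul_cpow K δ hs).differentiableWithinAt)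
    (isOpen_lt continuous_const Complex.continuous_re)
  have hreal : Tendsto (fun x : ℝ => (x : ℂ)) (𝓝[≠] 1) (𝓝[≠] ((1 : ℝ) : ℂ)) :=
    Complex.continuous_ofReal.continuousWithinAt.tendsto_nhdsWithin
      fun x hx h => hx (Complex.ofReal_injective h)
  have hfreq : ∃ᶠ z : ℂ in 𝓝[≠] ((1 : ℝ) : ℂ), complexMGF Y μ (-z) =
      Complex.exp (-((K : ℂ) * z ^ (δ : ℂ))) := by
    refine hreal.frequently (Eventually.frequently ?_)
    filter_upwards [nhdsWithin_le_nhds (Ioi_mem_nhds one_pos)] with x hx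
    exact hstable.complexMGF_neg_ofReal hx
  exact hstable.analyticOnNhd_complexMGF_neg.eqOn_of_preconnected_of_frequently_eq hright
    (convex_halfSpace_re_gt 0).isPreconnected (by simp) hfreq hs

theorem hasInverseLaplaceAt [IsFiniteMeasure μ] (hstable : HasStableLaplaceTransform Y K δ μ)
    (hY : Measurable Y) (hK : 0 < K) (hδ : δ ∈ Set.Ioo (0 : ℝ) 1) (t : ℝ) :
    HasInverseLaplaceAt (stableTransform K δ) 0 t (μ.real {w | Y w < t} : ℝ) := by
  have heq : Set.EqOn (fun s => 1 / s * complexMGF Y μ (-s)) (stableTransform K δ)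
      {s | 0 < s.re} := fun s hs => by simp only [hstable.complexMGF_neg hs, stableTransform]
  have hvert : ∀ γ : ℝ, 0 < γ → ∀ y : ℝ, (γ : ℂ) + y * Complex.I ∈ {s : ℂ | 0 < s.re} :=
    fun γ hγ y => by simpa using hγ
  refine (hasInverseLaplaceAt_complexMGF hY le_rfl (fun γ => hstable.neg_mem_integrableExpSet)
    (fun γ hγ => ?_) t).congr heq
  exact (integrable_stableTransform_vertical hK hδ hγ).congr
    (ae_of_all _ fun y => (heq (hvert γ hγ y)).symm)

end HasStableLaplaceTransform

end StableLaw

section ErrorFunction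

lemma hasDerivAt_erf (x : ℝ) : HasDerivAt erf (2 / √Real.pi * Real.exp (-x ^ 2)) x := by
  have hcont : Continuous fun t : ℝ => Real.exp (-t ^ 2) := by fun_prop
  exact (hcont.integral_hasStrictDerivAt 0 x).hasDerivAt.const_mul _

lemma erf_neg (x : ℝ) : erf (-x) = -erf x := by
  have heven := intervalIntegral.integral_comp_neg (a := 0) (b := x)
    fun t : ℝ => Real.exp (-t ^ 2)
  simp only [even_two, Even.neg_pow, neg_zero] at heven
  rw [erf, erf, intervalIntegral.integral_symm, ← heven, mul_neg]

lemma erf_eq_setIntegral {z : ℝ} (hz : 0 ≤ z) :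
    erf z = ∫ x in Set.Icc (-z) z, 1 / √Real.pi * Real.exp (-x ^ 2) := by
  have hcont : Continuous fun x : ℝ => 1 / √Real.pi * Real.exp (-x ^ 2) := by fun_prop
  have hneg := erf_neg z
  rw [erf, intervalIntegral.integral_symm] at hneg
  rw [integral_Icc_eq_integral_Ioc, ← intervalIntegral.integral_of_le (by linarith),
    ← intervalIntegral.integral_add_adjacent_intervals (hcont.intervalIntegrable _ 0)
      (hcont.intervalIntegrable _ _), intervalIntegral.integral_const_mul,
    intervalIntegral.integral_const_mul]
  rw [erf] at hneg ⊢
  linear_combination hneg / 2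

lemma tendsto_erf_atTop : Tendsto erf atTop (𝓝 1) := by
  have hint : IntegrableOn (fun x : ℝ => Real.exp (-x ^ 2)) (Set.Ioi 0) := by
    simpa using (integrable_exp_neg_mul_sq one_pos).integrableOn
  have hval : 2 / √Real.pi * ∫ x in Set.Ioi (0 : ℝ), Real.exp (-x ^ 2) = 1 := by
    have hgauss := integral_gaussian_Ioi 1
    simp only [neg_mul, one_mul, div_one] at hgauss
    rw [hgauss]
    field_simp
  rw [← hval]
  exact (intervalIntegral_tendsto_integral_Ioi 0 hint tendsto_id).const_mul _

lemma tendsto_erf_atBot : Tendsto erf atBot (𝓝 (-1)) :=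
  (tendsto_erf_atTop.comp tendsto_neg_atBot_atTop).neg.congr fun x => by simp [erf_neg]

end ErrorFunction

section HalfStable

theorem integral_Ioi_of_hasDerivAt_of_nonneg_of_tendsto {g g' : ℝ → ℝ} {a l m : ℝ}
    (hderiv : ∀ x ∈ Set.Ioi a, HasDerivAt g (g' x) x) (hg' : ∀ x ∈ Set.Ioi a, 0 ≤ g' x)
    (hm : Tendsto g (𝓝[>] a) (𝓝 m)) (hl : Tendsto g atTop (𝓝 l)) :
    ∫ x in Set.Ioi a, g' x = l - m := by
  have hcont : ContinuousWithinAt (Function.update g a m) (Set.Ici a) a := by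
    rwa [continuousWithinAt_update_same, Set.Ici_sdiff_left]
  have hderiv' : ∀ x ∈ Set.Ioi a, HasDerivAt (Function.update g a m) (g' x) x := fun x hx => by
    refine (hderiv x hx).congr_of_eventuallyEq ?_
    filter_upwards [eventually_ne_nhds hx.ne'] with y hy using Function.update_of_ne hy _ _
  have hl' : Tendsto (Function.update g a m) atTop (𝓝 l) := by
    refine hl.congr' ?_
    filter_upwards [eventually_ne_atTop a] with y hy using (Function.update_of_ne hy _ _).symm
  rw [integral_Ioi_of_hasDerivAt_of_nonneg hcont hderiv' hg' hl', Function.update_self]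

/-- An antiderivative on `(0, ∞)` of `(2 / √π) exp (-x² - (a / x)²)`, found by completing the
squares `(x ± a / x)² = x² + (a / x)² ± 2a`. -/
noncomputable def erfPrimitive (a x : ℝ) : ℝ :=
  (Real.exp (2 * a) * erf (x + a / x) + Real.exp (-(2 * a)) * erf (x - a / x)) / 2

variable {a : ℝ}

lemma hasDerivAt_erfPrimitive (a : ℝ) {x : ℝ} (hx : x ≠ 0) :
    HasDerivAt (erfPrimitive a)
      (2 / √Real.pi * Real.exp (-x ^ 2) * Real.exp (-(a / x) ^ 2)) x := by
  have hdiv : HasDerivAt (fun x : ℝ => a / x) (-(a / x ^ 2)) x := by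
    simpa [div_eq_mul_inv] using (hasDerivAt_inv hx).const_mul a
  have hadd := (hasDerivAt_erf (x + a / x)).comp x ((hasDerivAt_id x).add hdiv)
  have hsub := (hasDerivAt_erf (x - a / x)).comp x ((hasDerivAt_id x).sub hdiv)
  have hsq_add : Real.exp (2 * a) * Real.exp (-(x + a / x) ^ 2) =
      Real.exp (-x ^ 2) * Real.exp (-(a / x) ^ 2) := by
    rw [← Real.exp_add, ← Real.exp_add]; congr 1; field_simp; ring
  have hsq_sub : Real.exp (-(2 * a)) * Real.exp (-(x - a / x) ^ 2) =
      Real.exp (-x ^ 2) * Real.exp (-(a / x) ^ 2) := by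
    rw [← Real.exp_add, ← Real.exp_add]; congr 1; field_simp; ring
  refine (((hadd.const_mul (Real.exp (2 * a))).add
    (hsub.const_mul (Real.exp (-(2 * a))))).div_const 2).congr_deriv ?_
  linear_combination (1 / √Real.pi * (1 - a / x ^ 2)) * hsq_add +
    (1 / √Real.pi * (1 + a / x ^ 2)) * hsq_sub

lemma tendsto_erfPrimitive {l : Filter ℝ} {b c : ℝ}
    (hb : Tendsto (fun x => erf (x + a / x)) l (𝓝 b))
    (hc : Tendsto (fun x => erf (x - a / x)) l (𝓝 c)) :
    Tendsto (erfPrimitive a) l (𝓝 ((Real.exp (2 * a) * b + Real.exp (-(2 * a)) * c) / 2)) :=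
  ((hb.const_mul _).add (hc.const_mul _)).div_const 2

lemma tendsto_erfPrimitive_nhdsGT_zero (ha : 0 < a) : Tendsto (erfPrimitive a) (𝓝[>] 0)
    (𝓝 ((Real.exp (2 * a) * 1 + Real.exp (-(2 * a)) * -1) / 2)) := by
  have hid : Tendsto (fun x : ℝ => x) (𝓝[>] 0) (𝓝 0) := tendsto_id.mono_left nhdsWithin_le_nhds
  have hdiv : Tendsto (fun x : ℝ => a / x) (𝓝[>] 0) atTop := by
    simpa [div_eq_mul_inv] using tendsto_inv_nhdsGT_zero.const_mul_atTop ha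
  have hsub : Tendsto (fun x : ℝ => x - a / x) (𝓝[>] 0) atBot := by
    simp_rw [sub_eq_add_neg]
    exact hid.add_atBot (tendsto_neg_atTop_atBot.comp hdiv)
  exact tendsto_erfPrimitive (tendsto_erf_atTop.comp (hid.add_atTop hdiv))
    (tendsto_erf_atBot.comp hsub)

lemma tendsto_erfPrimitive_atTop (a : ℝ) : Tendsto (erfPrimitive a) atTop
    (𝓝 ((Real.exp (2 * a) * 1 + Real.exp (-(2 * a)) * 1) / 2)) := by
  have hdiv : Tendsto (fun x : ℝ => a / x) atTop (𝓝 0) := tendsto_const_nhds.div_atTop tendsto_id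
  have hsub : Tendsto (fun x : ℝ => x - a / x) atTop atTop := by
    simp_rw [sub_eq_add_neg]
    exact tendsto_id.atTop_add hdiv.neg
  exact tendsto_erfPrimitive (tendsto_erf_atTop.comp (tendsto_id.atTop_add hdiv))
    (tendsto_erf_atTop.comp hsub)

lemma integral_exp_neg_sq_mul_exp_neg_div_sq (ha : 0 < a) :
    ∫ x in Set.Ioi (0 : ℝ), 2 / √Real.pi * Real.exp (-x ^ 2) * Real.exp (-(a / x) ^ 2) =
      Real.exp (-(2 * a)) := by
  rw [integral_Ioi_of_hasDerivAt_of_nonneg_of_tendsto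
    (fun x hx => hasDerivAt_erfPrimitive a (ne_of_gt hx)) (fun x _ => by positivity)
    (tendsto_erfPrimitive_nhdsGT_zero ha) (tendsto_erfPrimitive_atTop a)]
  ring

lemma gaussianPDFReal_zero_half (x : ℝ) :
    gaussianPDFReal 0 (1 / 2) x = 1 / √Real.pi * Real.exp (-x ^ 2) := by
  rw [gaussianPDFReal]
  push_cast
  rw [show 2 * Real.pi * (1 / 2) = Real.pi by ring]
  simp

variable {K t : ℝ}

theorem hasStableLaplaceTransform_gaussianReal (hK : 0 < K) :
    HasStableLaplaceTransform (fun x => (K / (2 * x)) ^ 2) K (1 / 2) (gaussianReal 0 (1 / 2)) := by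
  intro s hs
  have hpdf : ∀ x : ℝ, gaussianPDFReal 0 (1 / 2) x • Real.exp (-s * (K / (2 * x)) ^ 2) =
      1 / √Real.pi * Real.exp (-|x| ^ 2) * Real.exp (-(K * √s / 2 / |x|) ^ 2) := fun x => by
    rw [gaussianPDFReal_zero_half, smul_eq_mul, sq_abs, div_pow _ |x|, sq_abs, div_pow (K * √s),
      mul_pow K, Real.sq_sqrt hs.le]
    ring_nf
  rw [mgf, integral_gaussianReal_eq_integral_smul (by norm_num), funext hpdf,
    integral_comp_abs (f := fun x => 1 / √Real.pi * Real.exp (-x ^ 2) *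
      Real.exp (-(K * √s / 2 / x) ^ 2)), ← integral_const_mul]
  calc ∫ x in Set.Ioi (0 : ℝ), 2 * (1 / √Real.pi * Real.exp (-x ^ 2) *
        Real.exp (-(K * √s / 2 / x) ^ 2))
      = Real.exp (-(2 * (K * √s / 2))) := by
        rw [← integral_exp_neg_sq_mul_exp_neg_div_sq (by positivity)]
        congr! 2
        ring
    _ = Real.exp (-(K * s ^ (1 / 2 : ℝ))) := by
        rw [← Real.sqrt_eq_rpow]
        ring_nf

lemma gaussianReal_zero_half_real_Icc {z : ℝ} (hz : 0 ≤ z) :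
    (gaussianReal 0 (1 / 2)).real (Set.Icc (-z) z) = erf z := by
  rw [measureReal_def, gaussianReal_apply_eq_integral _ (by norm_num), ENNReal.toReal_ofReal
    (setIntegral_nonneg measurableSet_Icc fun x _ => gaussianPDFReal_nonneg _ _ x),
    erf_eq_setIntegral hz]
  simp_rw [gaussianPDFReal_zero_half]

lemma gaussianReal_zero_half_real_sq_div_lt (hK : 0 < K) (ht : 0 < t) :
    (gaussianReal 0 (1 / 2)).real {x | (K / (2 * x)) ^ 2 < t} = 1 - erf (K / (2 * √t)) := by
  have : NullSingletonClass (gaussianReal 0 (1 / 2)) :=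
    nullSingletonClass_gaussianReal (by norm_num)
  set z : ℝ := K / (2 * √t) with hz
  have hset : {x : ℝ | (K / (2 * x)) ^ 2 < t} =ᵐ[gaussianReal 0 (1 / 2)] {x : ℝ | z < |x|} := by
    filter_upwards [Measure.ae_ne _ 0] with x hx
    refine propext ?_
    change (K / (2 * x)) ^ 2 < t ↔ z < |x|
    rw [← sq_abs, abs_div, abs_mul, abs_two, abs_of_pos hK, hz, ← Real.lt_sqrt (by positivity),
      div_lt_iff₀ (by positivity), div_lt_iff₀ (by positivity)]
    ring_nf
  have hcompl : {x : ℝ | z < |x|} = (Set.Icc (-z) z)ᶜ := by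
    ext x
    simp only [Set.mem_ofPred_eq, Set.mem_compl_iff, Set.mem_Icc, ← abs_le, not_le]
  rw [measureReal_congr hset, hcompl, probReal_compl_eq_one_sub measurableSet_Icc,
    gaussianReal_zero_half_real_Icc (by positivity)]

/-- The one-sided stable law of index `1 / 2` is that of `(K / (2 Z))²` with `Z` centred Gaussian
of variance `1 / 2`; inverting both Laplace transforms identifies the distribution functions. -/
theorem HasStableLaplaceTransform.measureReal_lt_of_half {Ω : Type*} [MeasurableSpace Ω]
    {μ : Measure Ω} [IsFiniteMeasure μ] {Y : Ω → ℝ}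
    (hstable : HasStableLaplaceTransform Y K (1 / 2) μ) (hY : Measurable Y) (hK : 0 < K)
    (ht : 0 < t) : μ.real {w | Y w < t} = 1 - erf (K / (2 * √t)) := by
  have hhalf : (1 / 2 : ℝ) ∈ Set.Ioo (0 : ℝ) 1 := by norm_num
  have hinv := hstable.hasInverseLaplaceAt hY hK hhalf t
  have hinv' := (hasStableLaplaceTransform_gaussianReal hK).hasInverseLaplaceAt
    (by fun_prop) hK hhalf t
  rw [Complex.ofReal_injective (hinv.unique hinv'), gaussianReal_zero_half_real_sq_div_lt hK ht]

end HalfStable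

section Finiteness

variable {Ω : Type*} [MeasurableSpace Ω] {μ : Measure Ω} {Z : Ω → ℝ≥0∞}

lemma ae_ne_top_of_tendsto_lintegral_expNeg [IsProbabilityMeasure μ] (hZ : Measurable Z)
    (hlim : Tendsto (fun s : ℝ => ∫⁻ w, expNeg (ENNReal.ofReal s * Z w) ∂μ) (𝓝[>] 0) (𝓝 1)) :
    ∀ᵐ w ∂μ, Z w ≠ ∞ := by
  have hset : MeasurableSet {w | Z w ≠ ∞} := (hZ (measurableSet_singleton ∞)).compl
  have hle : ∀ s : ℝ, 0 < s →
      ∫⁻ w, expNeg (ENNReal.ofReal s * Z w) ∂μ ≤ μ {w | Z w ≠ ∞} := fun s hs => by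
    rw [← lintegral_indicator_one hset]
    refine lintegral_mono fun w => ?_
    by_cases hw : Z w = ∞
    · simp [hw, ENNReal.mul_top, hs]
    · rw [Set.indicator_of_mem (show w ∈ {w | Z w ≠ ∞} from hw)]
      exact expNeg_le_one _
  have hfull : 1 ≤ μ {w | Z w ≠ ∞} := le_of_tendsto hlim (eventually_mem_nhdsWithin.mono hle)
  exact (mem_ae_iff_prob_eq_one hset).2 (prob_le_one.antisymm hfull)

lemma tendsto_ofReal_exp_neg_mul_rpow (K : ℝ) {δ : ℝ} (hδ : 0 < δ) :
    Tendsto (fun s : ℝ => ENNReal.ofReal (Real.exp (-(K * s ^ δ)))) (𝓝[>] 0) (𝓝 1) := by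
  have hcont : Continuous fun s : ℝ => ENNReal.ofReal (Real.exp (-(K * s ^ δ))) :=
    ENNReal.continuous_ofReal.comp
      ((Real.continuous_rpow_const hδ.le).const_mul K).neg.rexp
  simpa [Real.zero_rpow hδ.ne'] using
    (hcont.tendsto 0).mono_left (nhdsWithin_le_nhds (s := Set.Ioi 0))

lemma mgf_toReal_neg_eq_lintegral_expNeg (hZ : Measurable Z) (hfin : ∀ᵐ w ∂μ, Z w ≠ ∞) {s : ℝ}
    (hs : 0 ≤ s) :
    mgf (fun w => (Z w).toReal) μ (-s) = (∫⁻ w, expNeg (ENNReal.ofReal s * Z w) ∂μ).toReal := by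
  rw [mgf, integral_eq_lintegral_of_nonneg_ae (ae_of_all _ fun w => (Real.exp_pos _).le)
    (Measurable.aestronglyMeasurable (by fun_prop))]
  congr 1
  refine lintegral_congr_ae (hfin.mono fun w hw => ?_)
  simp only
  rw [expNeg_of_ne_top (ENNReal.mul_ne_top ENNReal.ofReal_ne_top hw), ENNReal.toReal_mul,
    ENNReal.toReal_ofReal hs, neg_mul]

end Finiteness

section Coverage

variable {Ω : Type*} [MeasurableSpace Ω] {μ : Measure Ω} {X : ℕ → Ω → Plane} {Θ : ℕ → Ω → ℝ}
  {LoS : ℕ → Ω → Bool} {G : ℕ → Ω → ℝ} {ν : Measure ℝ} {lam c₁ c₂ α ℓ : ℝ} {N : ℕ}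

lemma IsAPILNetwork.ae_shotSignal_ne_top (hnet : IsAPILNetwork μ X Θ LoS G ν lam c₁ c₂ N)
    (hlam : 0 < lam) (hc₂ : 0 ≤ c₂) (hN : 1 ≤ N) (hα : 2 < α) (hℓ : 0 ≤ ℓ) :
    ∀ᵐ w ∂μ, shotSignal X Θ LoS G α ℓ w ≠ ∞ := by
  have := hnet.isProbabilityMeasure
  refine ae_ne_top_of_tendsto_lintegral_expNeg (hnet.measurable_shotSignal α ℓ)
    ((tendsto_ofReal_exp_neg_mul_rpow (signalScale ν lam c₁ c₂ α ℓ N)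
      (by positivity : 0 < 2 / α)).congr' ?_)
  filter_upwards [self_mem_nhdsWithin] with s hs
  exact (hnet.lintegral_expNeg_shotSignal hlam hc₂ hN hα hℓ (le_of_lt hs)).symm

theorem IsAPILNetwork.hasStableLaplaceTransform_shotSignal
    (hnet : IsAPILNetwork μ X Θ LoS G ν lam c₁ c₂ N) (hlam : 0 < lam) (hc₂ : 0 ≤ c₂)
    (hN : 1 ≤ N) (hα : 2 < α) (hℓ : 0 ≤ ℓ) :
    HasStableLaplaceTransform (fun w => (shotSignal X Θ LoS G α ℓ w).toReal)
      (signalScale ν lam c₁ c₂ α ℓ N) (2 / α) μ := fun s hs => by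
  rw [mgf_toReal_neg_eq_lintegral_expNeg (hnet.measurable_shotSignal α ℓ)
    (hnet.ae_shotSignal_ne_top hlam hc₂ hN hα hℓ) hs.le,
    hnet.lintegral_expNeg_shotSignal hlam hc₂ hN hα hℓ hs.le,
    ENNReal.toReal_ofReal (Real.exp_pos _).le]

lemma cellFreeCoverage_eq_one_sub [IsProbabilityMeasure μ] {P σ₀ β : ℝ}
    (hmeas : Measurable (shotSignal X Θ LoS G α ℓ))
    (hfin : ∀ᵐ w ∂μ, shotSignal X Θ LoS G α ℓ w ≠ ∞) (hP : 0 < P) (hσ₀ : 0 < σ₀) :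
    cellFreeCoverage μ X Θ LoS G α ℓ P σ₀ β =
      1 - μ.real {w | (shotSignal X Θ LoS G α ℓ w).toReal < β * σ₀ / P} := by
  rw [← probReal_compl_eq_one_sub (measurableSet_lt hmeas.ennreal_toReal measurable_const),
    cellFreeCoverage]
  refine measureReal_congr (hfin.mono fun w hw => propext ?_)
  change ENNReal.ofReal β ≤ ENNReal.ofReal P * shotSignal X Θ LoS G α ℓ w / ENNReal.ofReal σ₀ ↔
    ¬ (shotSignal X Θ LoS G α ℓ w).toReal < β * σ₀ / P
  lift shotSignal X Θ LoS G α ℓ w to ℝ≥0 using hw with S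
  rw [not_lt, div_le_iff₀ hP, ENNReal.coe_toReal, ← ENNReal.ofReal_coe_nnreal,
    ← ENNReal.ofReal_mul hP.le, ← ENNReal.ofReal_div_of_pos hσ₀,
    ENNReal.ofReal_le_ofReal_iff (by positivity), le_div_iff₀ hσ₀, mul_comm P]

lemma signalScale_four_div (ν : Measure ℝ) (lam c₁ c₂ ℓ : ℝ) (N : ℕ) (t : ℝ) :
    signalScale ν lam c₁ c₂ 4 ℓ N / (2 * √t) =
      Real.pi ^ (3 / 2 : ℝ) * lam * omega ν c₁ c₂ 4 ℓ / (2 * (N - 1).factorial) * √t⁻¹ *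
        Real.Gamma (N + 1 / 2) := by
  have hpi : Real.pi ^ (3 / 2 : ℝ) = Real.pi * √Real.pi := by
    rw [Real.sqrt_eq_rpow, ← Real.rpow_one_add' Real.pi_pos.le (by norm_num)]
    norm_num
  have hhalf : (2 : ℝ) / 4 = 1 / 2 := by norm_num
  rw [signalScale, hpi, hhalf, sub_half, Real.Gamma_one_half_eq, Real.sqrt_inv]
  ring

end Coverage

end UAV

theorem proposition2_general {Ω : Type*} [MeasurableSpace Ω] {μ : Measure Ω}
    {X : ℕ → Ω → UAV.Plane} {Θ : ℕ → Ω → ℝ} {LoS : ℕ → Ω → Bool} {G : ℕ → Ω → ℝ}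
    {ν : Measure ℝ} {lam c₁ c₂ α ℓ P σ₀ β : ℝ} {N : ℕ}
    (hlam : 0 < lam) (hc₂ : 0 ≤ c₂) (hα : 2 < α) (hℓ : 0 ≤ ℓ)
    (hP : 0 < P) (hσ₀ : 0 < σ₀) (hβ : 0 < β) (hN : 1 ≤ N)
    (hnet : UAV.IsAPILNetwork μ X Θ LoS G ν lam c₁ c₂ N) :
    (∃ v : ℝ,
      UAV.HasInverseLaplaceAt
        (fun s : ℂ => 1 / s * Complex.exp
          (-(((Real.pi * lam * UAV.omega ν c₁ c₂ α ℓ / (N - 1).factorial *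
              Real.Gamma (N + 2 / α) * Real.Gamma (1 - 2 / α) : ℝ) : ℂ) *
            s ^ ((2 / α : ℝ) : ℂ))))
        0 (β * σ₀ / P) (v : ℂ) ∧
      UAV.cellFreeCoverage μ X Θ LoS G α ℓ P σ₀ β = 1 - v) ∧
    (α = 4 →
      UAV.cellFreeCoverage μ X Θ LoS G α ℓ P σ₀ β =
        UAV.erf (Real.pi ^ (3 / 2 : ℝ) * lam * UAV.omega ν c₁ c₂ α ℓ /
          (2 * (N - 1).factorial) * √(P / (β * σ₀)) * Real.Gamma (N + 1 / 2))) := by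
  have := hnet.isProbabilityMeasure
  have := hnet.isProbabilityMeasure_angle
  have hmeas := hnet.measurable_shotSignal α ℓ
  have hK := UAV.signalScale_pos (c₁ := c₁) hlam hc₂ hα hℓ hnet.angle_mem N
  have hδ : 2 / α ∈ Set.Ioo (0 : ℝ) 1 := ⟨by positivity, (div_lt_one (by linarith)).2 hα⟩
  have hstable := hnet.hasStableLaplaceTransform_shotSignal hlam hc₂ hN hα hℓ
  have hcov := UAV.cellFreeCoverage_eq_one_sub (β := β) hmeas
    (hnet.ae_shotSignal_ne_top hlam hc₂ hN hα hℓ) hP hσ₀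
  refine ⟨⟨_, hstable.hasInverseLaplaceAt hmeas.ennreal_toReal hK hδ _, hcov⟩, ?_⟩
  rintro rfl
  rw [show (2 : ℝ) / 4 = 1 / 2 by norm_num] at hstable
  rw [hcov, hstable.measureReal_lt_of_half hmeas.ennreal_toReal hK (by positivity),
    sub_sub_cancel, UAV.signalScale_four_div, inv_div]

theorem proposition2 {Ω : Type*} [MeasurableSpace Ω] (μ : Measure Ω) [IsProbabilityMeasure μ]
    (X : ℕ → Ω → UAV.Plane) (Θ : ℕ → Ω → ℝ) (LoS : ℕ → Ω → Bool) (G : ℕ → Ω → ℝ)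
    (ν : Measure ℝ) (lam c₁ c₂ α ℓ P σ₀ β : ℝ) (N : ℕ)
    (hlam : 0 < lam) (hc₁ : 0 < c₁) (hc₂ : 0 < c₂) (hα : 2 < α) (hℓ : ℓ ∈ Set.Icc (0 : ℝ) 1)
    (hP : 0 < P) (hσ₀ : 0 < σ₀) (hβ : 0 < β) (hN : 1 ≤ N)
    (hnet : UAV.IsAPILNetwork μ X Θ LoS G ν lam c₁ c₂ N) :
    (∃ v : ℝ,
      UAV.HasInverseLaplaceAt
        (fun s : ℂ => 1 / s * Complex.exp
          (-(((Real.pi * lam * UAV.omega ν c₁ c₂ α ℓ / (N - 1).factorial *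
              Real.Gamma (N + 2 / α) * Real.Gamma (1 - 2 / α) : ℝ) : ℂ) *
            s ^ ((2 / α : ℝ) : ℂ))))
        0 (β * σ₀ / P) (v : ℂ) ∧
      UAV.cellFreeCoverage μ X Θ LoS G α ℓ P σ₀ β = 1 - v) ∧
    (α = 4 →
      UAV.cellFreeCoverage μ X Θ LoS G α ℓ P σ₀ β =
        UAV.erf (Real.pi ^ (3 / 2 : ℝ) * lam * UAV.omega ν c₁ c₂ α ℓ /
          (2 * (N - 1).factorial) * √(P / (β * σ₀)) * Real.Gamma (N + 1 / 2))) :=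
  proposition2_general hlam hc₂.le hα hℓ.1 hP hσ₀ hβ hN hnet
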